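/- \textbf{Setting.} Let $\tau\in\mathbb H$. Let $A$ be the complex vector space with basis $\mathrm{id}_{\mathcal O},\mathrm{id}_L,\theta$ in degree $0$ and $\xi,\xi_L,\eta$ in degree $1$, and put $|x|'=|x|-1$. Equip $A$ with the skew-symmetric pairing whose only non-zero values on basis vectors are $\langle \mathrm{id}_{\mathcal O},\xi\rangle=\langle \mathrm{id}_L,\xi_L\rangle=\langle\theta,\eta\rangle=1=-\langle\xi,\mathrm{id}_{\mathcal O}\rangle=-\langle\xi_L,\mathrm{id}_L\rangle=-\langle\eta,\theta\rangle$. A Hochschild $n$-cochain is a family $f=(f_k)_{k\ge 0}$ of multilinear maps $f_k:A[1]^{\otimes k}\to A[1]$ of degree $n-1$. It is cyclic if $\langle f(x_1,\dots,x_{k-1}),x_k\rangle=(-1)^{|x_1|'(|x_2|'+\cdots+|x_k|')}\langle f(x_2,\dots,x_k),x_1\rangle$. For cochains $f,g$ of shifted degrees $p,q$ (an $n$-cochain has shifted degree $n-1$) put $[f,g]=f\circ g-(-1)^{pq}g\circ f$, where $$(f\circ g)(x_1,\dots,x_n)=\sum_{0\le i\le j\le n}(-1)^{q(|x_1|'+\cdots+|x_i|')}f(x_1,\dots,x_i,g(x_{i+1},\dots,x_j),x_{j+1},\dots,x_n).$$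 For even $k\ge 2$ let $e_k(\tau)=\sum_m\sum_n (m\tau+n)^{-k}$ (sum over $m,n\in\mathbb Z$, not both $0$, first over $n$, then over $m$), $e_2^*=e_2-\frac{2\pi i}{\tau-\bar\tau}$, and $e_k^*=e_k$ for $k\ge4$. Let $\widehat\partial=\partial_\tau+\frac{\mathrm{wt}}{\tau-\bar\tau}$, which maps functions of weight $\mathrm{wt}$ to functions of weight $\mathrm{wt}+2$; here $e_k^*$ has weight $k$. For $p,q\ge0$ with $p+q$ odd let $g_{p,q}=g_{q,p}$, with $g_{p,q}=(2\pi i\,\widehat\partial)^q\big((p-q)!\,e^*_{p-q+1}\big)$ if $p>q$. Let $\mu^*=(\mu_k)_k$ be the multiplications of Polishchuk's algebra $A_\tau$ on $A$, in the shifted sign convention. They are as follows. First, $\mu_2(x,y)=(-1)^{|x|'}xy$ on basis vectors, where $xy$ is the Yoneda product (first $x$, then $y$), for which $\mathrm{id}_{\mathcal O}$ and $\mathrm{id}_L$ are the identities of two objects $\mathcal O$ and $L$, $\xi:\mathcal O\to\mathcal O[1]$, $\xi_L:L\to L[1]$, $\theta:\mathcal O\to L$, $\eta:L\to\mathcal O[1]$,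 and the only non-zero products not involving identities are $\theta\cdot\eta=\xi$ and $\eta\cdot\theta=\xi_L$; thus $\mu_2(\theta,\eta)=-\xi$ and $\mu_2(\eta,\theta)=\xi_L$. For $a,b,c,d\ge0$ with $s=a+b+c+d$ odd and $k=s+3$, $$\mu_k(\xi_L^a,\eta,\xi^b,\theta,\xi_L^c,\eta,\xi^d)=(-1)^{a+b}\,\frac{1}{a!\,b!\,c!\,d!}\,\frac{1}{(2\pi i)^{s+1}}\,g_{a+c,b+d}(\tau)\;\eta .$$ All other values of the $\mu_k$ on basis vectors are those obtained from these by cyclic rotation, and the remaining ones are zero. \textbf{Theorem.} $\mu^*$ is a cyclic Hochschild $2$-cochain with the values displayed above. Its structure constants are (real-)differentiable functions of $\tau$. Let $\psi_3:A[1]^{\otimes3}\to A[1]$ be the cyclic Hochschild $1$-cochain given by $$\psi_3(\xi,\theta,\xi_L)=-\frac1{2\pi i}\cdot\frac1{(\tau-\bar\tau)^2}\cdot\theta$$ and its cyclic rotations with respect to the pairing, and zero on all other words in the basis. Then, with $\bar\partial=\partial/\partial\bar\tau$ applied to all structure constants, $$\bar\partial\mu^*=[\mu^*,\psi_3].$$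 That is, the antiholomorphic variation $\bar\partial\mu^*$ is the image of $\psi_3$ under the Hochschild differential $[\mu^*,-]$, so it is trivial to first order. -/

import Mathlib

open Complex
open scoped UpperHalfPlane

noncomputable section

namespace Polishchuk

/-! ### Eisenstein series and the almost holomorphic modular forms `g_{p,q}` -/

/-- The Wirtinger derivative `∂f/∂τ = (∂f/∂x - i ∂f/∂y) / 2`. -/
def dTau (f : ℂ → ℂ) (z : ℂ) : ℂ :=
  (fderiv ℝ f z 1 - I * fderiv ℝ f z I) / 2

/-- The Wirtinger derivative `∂f/∂τ̄ = (∂f/∂x + i ∂f/∂y) / 2`. -/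
def dTauBar (f : ℂ → ℂ) (z : ℂ) : ℂ :=
  (fderiv ℝ f z 1 + I * fderiv ℝ f z I) / 2

/-- The function `τ - τ̄`. -/
def tauDiff (z : ℂ) : ℂ := z - (starRingEnd ℂ) z

/-- The Eisenstein series `e_k(τ) = ∑_m ∑_n (m τ + n)^{-k}`, the term `m = n = 0` being omitted
(it is `0⁻¹ = 0`), for even `k ≥ 2`. The order of summation matters only for `k = 2`. -/
def eis (k : ℕ) (z : ℂ) : ℂ :=
  ∑' m : ℤ, ∑' n : ℤ, (((m : ℂ) * z + (n : ℂ)) ^ k)⁻¹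

/-- `e_2^* = e_2 - 2πi / (τ - τ̄)`, and `e_k^* = e_k` for `k ≠ 2`. -/
def eisStar (k : ℕ) (z : ℂ) : ℂ :=
  if k = 2 then eis 2 z - 2 * Real.pi * I / tauDiff z else eis k z

/-- The operator `∂_τ + k / (τ - τ̄)` on forms of weight `k`; it raises the weight by `2`. -/
def raise (k : ℕ) (f : ℂ → ℂ) (z : ℂ) : ℂ :=
  dTau f z + (k : ℂ) / tauDiff z * f z

/-- The `j`-fold iterate of the raising operator on a form of weight `k`. -/
def raiseIter (k : ℕ) (f : ℂ → ℂ) : ℕ → ℂ → ℂ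
  | 0 => f
  | j + 1 => raise (k + 2 * j) (raiseIter k f j)

/-- For `p ≥ q` with `p + q` odd this is `g_{p,q} = (2πi)^q ∂̂^q ((p-q)! e_{p-q+1}^*)`, an almost
holomorphic modular form of weight `p + q + 1`; moreover `g_{p,q} = g_{q,p}`. -/
def gForm (p q : ℕ) (z : ℂ) : ℂ :=
  (2 * Real.pi * I) ^ (min p q) *
    raiseIter (max p q - min p q + 1)
      (fun w => (((max p q - min p q).factorial : ℕ) : ℂ) * eisStar (max p q - min p q + 1) w)
      (min p q) z

/-! ### The graded vector space with its pairing -/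

/-- The homogeneous basis of the algebra: `id_𝒪`, `id_L`, `ξ`, `ξ_L`, `θ`, `η`. -/
inductive Gen
  | idO | idL | xi | xiL | theta | eta
  deriving DecidableEq

instance : Fintype Gen :=
  ⟨{.idO, .idL, .xi, .xiL, .theta, .eta}, fun x => by cases x <;> decide⟩

/-- The underlying vector space, with basis `Gen`. -/
abbrev Alg : Type := Gen → ℂ

/-- The basis vector attached to a generator. -/
def vec (x : Gen) : Alg := Pi.single x 1

/-- The degree: `id_𝒪`, `id_L`, `θ` have degree `0`, and `ξ`, `ξ_L`, `η` have degree `1`. -/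
def deg : Gen → ℤ
  | .idO => 0
  | .idL => 0
  | .theta => 0
  | .xi => 1
  | .xiL => 1
  | .eta => 1

/-- The shifted degree `|x|' = |x| - 1`. -/
def sdeg (x : Gen) : ℤ := deg x - 1

/-- The total shifted degree of a word. -/
def wdeg (w : List Gen) : ℤ := (w.map sdeg).sum

/-- The sign `(-1)^n` as a complex number. -/
def sgn (n : ℤ) : ℂ := ((Int.negOnePow n : ℤ) : ℂ)

/-- The skew-symmetric pairing on generators. -/
def pairGen : Gen → Gen → ℂ
  | .idO, .xi => 1
  | .xi, .idO => -1
  | .idL, .xiL => 1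
  | .xiL, .idL => -1
  | .theta, .eta => 1
  | .eta, .theta => -1
  | _, _ => 0

/-- The skew-symmetric pairing `⟨v, w⟩`. -/
def pairing (v w : Alg) : ℂ := ∑ x, ∑ y, v x * w y * pairGen x y

/-- The generator which pairs non-trivially with the given one. -/
def dual : Gen → Gen
  | .idO => .xi
  | .xi => .idO
  | .idL => .xiL
  | .xiL => .idL
  | .theta => .eta
  | .eta => .theta

/-! ### Hochschild cochains -/

/-- Hochschild cochains: families of multilinear maps `A^{⊗ k} → A`, `k ≥ 0`. -/
abbrev Cochain : Type := (k : ℕ) → MultilinearMap ℂ (fun _ : Fin k => Alg) Alg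

/-- The value `f(x_1, …, x_k)` of a cochain on a word of basis vectors. -/
def Cochain.onWord (f : Cochain) (w : List Gen) : Alg :=
  f w.length (fun i => vec (w.get i))

/-- The cochain with prescribed values on all words of basis vectors. -/
def ofWords (F : List Gen → Alg) : Cochain := fun k =>
  ∑ w : Fin k → Gen,
    ((MultilinearMap.mkPiAlgebra ℂ (Fin k) ℂ).compLinearMap
      (fun i => (LinearMap.proj (w i) : Alg →ₗ[ℂ] ℂ))).smulRight (F (List.ofFn w))

theorem onWord_ofWords (F : List Gen → Alg) (w : List Gen) : (ofWords F).onWord w = F w := by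
  unfold Cochain.onWord ofWords
  rw [sum_apply, Finset.sum_eq_single (fun i => w.get i)]
  · simp [vec]
  · intro v _ hv
    obtain ⟨i, hi⟩ := Function.ne_iff.mp hv
    have h0 : ∏ j, (Pi.single (w.get j) (1 : ℂ) : Alg) (v j) = 0 :=
      Finset.prod_eq_zero (Finset.mem_univ i) (by rw [Pi.single_apply, if_neg hi])
    simp only [MultilinearMap.smulRight_apply, MultilinearMap.compLinearMap_apply,
      MultilinearMap.mkPiAlgebra_apply, LinearMap.proj_apply, vec]
    rw [h0, zero_smul]
  · simp

/-- `f` is a Hochschild `n`-cochain: all its components `A[1]^{⊗ k} → A[1]` have degree `n - 1`. -/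
def IsHochschild (n : ℤ) (f : Cochain) : Prop :=
  ∀ (w : List Gen) (x : Gen), f.onWord w x ≠ 0 → sdeg x = wdeg w + (n - 1)

/-- The insertion `f ∘ g`, where `p` is the shifted degree of `g`: its value on `x_1, …, x_n` is
`∑_{i ≤ j} (-1)^{p (|x_1|' + ⋯ + |x_i|')} f(x_1, …, x_i, g(x_{i+1}, …, x_j), x_{j+1}, …, x_n)`. -/
def circ (p : ℤ) (f g : Cochain) : Cochain := ofWords fun w =>
  ∑ j ∈ Finset.range (w.length + 1), ∑ i ∈ Finset.range (j + 1),
    sgn (p * wdeg (w.take i)) •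
      ∑ b : Gen, g.onWord ((w.take j).drop i) b • f.onWord (w.take i ++ b :: w.drop j)

/-- The Gerstenhaber bracket `[f, g] = f ∘ g - (-1)^{(m-1)(n-1)} g ∘ f` of a Hochschild
`m`-cochain `f` and a Hochschild `n`-cochain `g`. -/
def bracket (m n : ℤ) (f g : Cochain) : Cochain :=
  circ (n - 1) f g - sgn ((m - 1) * (n - 1)) • circ (m - 1) g f

/-- A cochain is cyclic if `c(x_1, …, x_k) = ⟨f(x_1, …, x_{k-1}), x_k⟩` is invariant under cyclic
rotation up to the Koszul sign of the shifted degrees. -/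
def IsCyclic (f : Cochain) : Prop :=
  ∀ (x y : Gen) (w : List Gen),
    pairing (f.onWord (x :: w)) (vec y) =
      sgn (sdeg x * (wdeg w + sdeg y)) * pairing (f.onWord (w ++ [y])) (vec x)

/-- The sum `∑_r ± c(x_{r+1}, …, x_n, x_1, …, x_r)` over the cyclic rotations of a word, with
Koszul signs. -/
def cyclicSum (c : List Gen → ℂ) (w : List Gen) : ℂ :=
  ∑ r ∈ Finset.range w.length, sgn (wdeg (w.take r) * wdeg (w.drop r)) * c (w.rotate r)

/-- The cochain `f` with `⟨f(x_1, …, x_{k-1}), x_k⟩ = c(x_1, …, x_k)`. -/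
def ofTensor (c : List Gen → ℂ) : Cochain :=
  ofWords fun w x => pairGen x (dual x) * c (w ++ [dual x])

/-! ### The multiplications -/

/-- The Yoneda product of generators (in reverse notation: `x y` is first `x`, then `y`). -/
def yoneda : Gen → Gen → Alg
  | .idO, .idO => vec .idO
  | .idO, .xi => vec .xi
  | .xi, .idO => vec .xi
  | .idO, .theta => vec .theta
  | .theta, .idL => vec .theta
  | .idL, .idL => vec .idL
  | .idL, .xiL => vec .xiL
  | .xiL, .idL => vec .xiL
  | .idL, .eta => vec .eta
  | .eta, .idO => vec .eta
  | .theta, .eta => vec .xi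
  | .eta, .theta => vec .xiL
  | _, _ => 0

/-- `μ_2(x, y) = (-1)^{|x|'} x y`; in particular `μ_2(θ, η) = -ξ` and `μ_2(η, θ) = ξ_L`. -/
def mu2 : Cochain := ofWords fun
  | [x, y] => sgn (sdeg x) • yoneda x y
  | _ => 0

/-- The word `ξ_L^a η ξ^b θ ξ_L^c η ξ^d`. -/
def polWord (a b c d : ℕ) : List Gen :=
  List.replicate a .xiL ++ [.eta] ++ List.replicate b .xi ++ [.theta] ++
    List.replicate c .xiL ++ [.eta] ++ List.replicate d .xi

/-- The coefficient of `η` in `μ_k(ξ_L^a, η, ξ^b, θ, ξ_L^c, η, ξ^d)` for `s = a+b+c+d` odd: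
`(-1)^{a+b} / (a! b! c! d!) * (2πi)^{-(s+1)} * g_{a+c,b+d}`. -/
def polCoeff (a b c d : ℕ) (z : ℂ) : ℂ :=
  (-1) ^ (a + b) / ((a.factorial * b.factorial * c.factorial * d.factorial : ℕ) : ℂ) *
    (1 / (2 * Real.pi * I) ^ (a + b + c + d + 1)) * gForm (a + c) (b + d) z

/-- The function on words which is `⟨μ_k(ξ_L^a, …, ξ^d), θ⟩` on `ξ_L^a η ξ^b θ ξ_L^c η ξ^d θ` with
`a+b+c+d` odd, and zero on all other words. -/
def polBase (z : ℂ) (w : List Gen) : ℂ :=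
  ∑ a ∈ Finset.range w.length, ∑ b ∈ Finset.range w.length,
    ∑ c ∈ Finset.range w.length, ∑ d ∈ Finset.range w.length,
      if Odd (a + b + c + d) ∧ w = polWord a b c d ++ [.theta] then
        polCoeff a b c d z * pairGen .eta .theta
      else 0

/-- The cochain `μ^*` of all multiplications of the algebra at `z`: the product `μ_2`, and the
cyclic extension of the higher multiplications. Every cyclic word
`ξ_L^a η ξ^b θ ξ_L^c η ξ^d θ` is presented exactly twice, by `(a,b,c,d)` and by `(c,d,a,b)`, with
the same contribution; hence the factor `1/2`. -/
def mu (z : ℂ) : Cochain :=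
  mu2 + ofTensor fun w => (1 / 2) * cyclicSum (polBase z) w

/-- The cyclic cochain given by `ψ_3(ξ, θ, ξ_L) = -(1/2πi) (τ-τ̄)^{-2} θ` and its cyclic
rotations. -/
def psi3 (z : ℂ) : Cochain :=
  ofTensor (cyclicSum fun w =>
    if w = [.xi, .theta, .xiL, .eta] then
      -(1 / (2 * Real.pi * I)) * (1 / tauDiff z ^ 2) * pairGen .theta .eta
    else 0)

/-- The antiholomorphic derivative of a family of cochains: the operator `∂/∂τ̄` is applied to all
structure constants. -/
def dbar (f : ℂ → Cochain) (z : ℂ) : Cochain :=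
  ofWords fun w x => dTauBar (fun t => (f t).onWord w x) z

end Polishchuk

end

/-!
The structure constants of `μ^*` are organised by cyclic words. A cyclic cochain is the same as a
function on words, its tensor `c(x_1, …, x_n) = ⟨f(x_1, …, x_{n-1}), x_n⟩`, which is invariant under
rotation up to Koszul signs; every tensor needed here is a combination of the functions
`rotCount v`, which count with signs the rotations of a word that are equal to `v`.

*The bracket.* The tensor of `[T, Ψ]`, for `Ψ` with four letters, is the sum over all three-letter
subwords of a cyclic word of the values of `T` after `Ψ` has been applied to the subword: the
subwords which avoid the last letter come from `T ∘ Ψ`, and those which contain it come from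
`Ψ ∘ T` (`bracket_ofTensor`). Dually, contracting subwords of `u` and comparing with `v` is the same
as expanding letters of `v` and comparing with `u` (`cyclicSum_contract_rotCount`). Hence `[-, ψ_3]`
acts on cyclic words as `-(1/2πi) (τ-τ̄)^{-2}` times the derivation with `θ ↦ ξ θ ξ_L`,
`η ↦ -ξ_L η ξ`, `id_𝒪 ↦ θ ξ_L η` and `id_L ↦ η ξ θ`. On the word `ξ_L^a η ξ^b θ ξ_L^c η ξ^d θ` it
raises two adjacent exponents by one, in four ways (`psiDerivation_cycWord`). On the tensor of `μ_2`
the words with identities cancel, and what remains are the words with `a + b + c + d = 1`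
(`cyclicSum_contractHead_mu2Tensor`).

*The forms.* The lowering operator `(τ-τ̄)² ∂/∂τ̄` annihilates `e_k^*` for `k ≥ 4`, sends `e_2^*` to
`-2πi`, and satisfies a commutation relation with `∂̂` (`lower_raise`). By induction it sends
`g_{p,q}` to `2πi p q g_{p-1,q-1}` for `p, q ≥ 1`, and `g_{1,0}` to `-2πi` (`lower_gForm`). The
Eisenstein series are holomorphic since they are given by their `q`-expansions, also for `k = 2`
(`eis_eq_tsum_sigma`).

*The comparison.* For the coefficient of the cyclic word of `(a, b, c, d)` one has `p = a + c` and
`q = b + d`, and the four terms of `p q = a b + b c + c d + a d` are the four ways in which this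
word arises from the derivation of shorter ones, while the exceptional value on `g_{1,0}` matches
the contribution of `μ_2` (`dTauBar_polConst_mul_polForm`, `dTauBar_muTensor`).
-/

noncomputable section

namespace Polishchuk

open UpperHalfPlane (upperHalfPlaneSet isOpen_upperHalfPlaneSet)

/-! ### The Eisenstein series are holomorphic -/

theorem norm_cexp_two_pi_I_mul (z : ℂ) :
    ‖cexp (2 * Real.pi * I * z)‖ = Real.exp (-(2 * Real.pi * z.im)) := by
  rw [Complex.norm_exp]
  congr 1
  simp

theorem differentiableOn_tsum_sigma_mul_cexp_pow (k : ℕ) :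
    DifferentiableOn ℂ (fun z : ℂ => ∑' n : ℕ+,
      (ArithmeticFunction.sigma k n : ℂ) * cexp (2 * Real.pi * I * z) ^ (n : ℕ))
      upperHalfPlaneSet := by
  intro z hz
  have hz' : 0 < z.im := hz
  -- on the half plane `im w > im z / 2` the terms are bounded by those at the point `i im z / 2`
  let y : ℍ := ⟨(z.im / 2 : ℝ) * I, by simpa using hz'⟩
  have hy : (y : ℂ).im = z.im / 2 := by
    change ((z.im / 2 : ℝ) * I : ℂ).im = _
    rw [Complex.im_ofReal_mul, I_im, mul_one]
  have hs := (EisensteinSeries.summable_sigma_mul_cexp_pow (k := k + 1) (by omega) y).norm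
  have hopen : IsOpen {w : ℂ | z.im / 2 < w.im} := isOpen_lt continuous_const continuous_im
  refine ((differentiableOn_tsum_of_summable_norm
    (hs.comp_injective PNat.coe_injective) (fun n => ?_) hopen
      (fun n w hw => ?_)).differentiableAt (hopen.mem_nhds ?_)).differentiableWithinAt
  · fun_prop
  · simp only [norm_mul, norm_pow, norm_cexp_two_pi_I_mul, Function.comp, add_tsub_cancel_right]
    gcongr
    rw [hy]
    exact le_of_lt hw
  · simpa using hz'

/-- For even `k ≥ 2` the Eisenstein series is the sum of a constant and of a multiple of
`∑ σ_{k-1}(n) q^n`, by the Lipschitz formula for the inner sums. -/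
theorem eis_eq_tsum_sigma {k : ℕ} (hk : 2 ≤ k) (hk2 : Even k) {z : ℂ} (hz : z ∈ upperHalfPlaneSet) :
    eis k z = (∑' n : ℤ, ((n : ℂ) ^ k)⁻¹) +
      2 * ((-2 * Real.pi * I) ^ k / ((k - 1).factorial : ℂ) * ∑' n : ℕ+,
        (ArithmeticFunction.sigma (k - 1) n : ℂ) * cexp (2 * Real.pi * I * z) ^ (n : ℕ)) := by
  have hq : ‖cexp (2 * Real.pi * I * z)‖ < 1 := UpperHalfPlane.norm_exp_two_pi_I_lt_one ⟨z, hz⟩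
  set C : ℂ := (-2 * Real.pi * I) ^ k / ((k - 1).factorial : ℂ) with hC
  set f : ℤ → ℂ := fun m => ∑' n : ℤ, (((m : ℂ) * z + (n : ℂ)) ^ k)⁻¹ with hf
  have hfe : f.Even := by
    intro m
    simp only [hf]
    rw [← (Equiv.neg ℤ).tsum_eq]
    refine tsum_congr fun n => ?_
    simp only [Equiv.neg_apply, Int.cast_neg]
    rw [show -(m : ℂ) * z + -(n : ℂ) = -((m : ℂ) * z + n) by ring, hk2.neg_pow]
  have hfm (m : ℕ+) : f m = C * ∑' n : ℕ+, (n : ℂ) ^ (k - 1) *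
      cexp (2 * Real.pi * I * z) ^ (m * n : ℕ) := by
    have h := EisensteinSeries.qExpansion_identity_pnat (k := k - 1) (by omega)
      ⟨m * z, by simpa using hz⟩
    rw [show k - 1 + 1 = k by omega] at h
    simp only [one_div] at h
    refine (Eq.trans ?_ h).trans ?_
    · rfl
    · congr 1
      refine tsum_congr fun n => ?_
      congr 1
      rw [← Complex.exp_nat_mul, ← Complex.exp_nat_mul]
      congr 1
      push_cast
      ring
  have hsum : Summable fun m : ℕ+ => f m := by
    refine ((summable_prod_mul_pow (k - 1) hq).prod.mul_left C).congr fun m => ?_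
    rw [hfm]
  have hnat : Summable fun m : ℕ => f m := by
    rw [← summable_pnat_iff_summable_nat (f := fun m : ℕ => f m)]
    exact hsum
  have hint : Summable f := Summable.of_nat_of_neg hnat (by simpa only [hfe _] using hnat)
  have h := tsum_int_eq_zero_add_two_mul_tsum_pnat hfe hint
  change ∑' m, f m = _
  rw [h]
  congr 1
  · simp [hf]
  · rw [tsum_congr hfm, tsum_mul_left, tsum_prod_pow_eq_tsum_sigma (k - 1) hq, nsmul_eq_mul]
    norm_num

theorem differentiableOn_eis {k : ℕ} (hk : 2 ≤ k) (hk2 : Even k) :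
    DifferentiableOn ℂ (eis k) upperHalfPlaneSet :=
  ((((differentiableOn_tsum_sigma_mul_cexp_pow (k - 1)).const_mul _).const_mul _).const_add
    _).congr fun _ hz => eis_eq_tsum_sigma hk hk2 hz

/-! ### Wirtinger calculus on the upper half plane -/

/-- Real smoothness on the upper half plane. -/
abbrev SmoothUpper (f : ℂ → ℂ) : Prop := ContDiffOn ℝ (⊤ : ℕ∞) f upperHalfPlaneSet

theorem SmoothUpper.differentiableAt {f : ℂ → ℂ} (hf : SmoothUpper f) {z : ℂ}
    (hz : z ∈ upperHalfPlaneSet) : DifferentiableAt ℝ f z :=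
  (hf.differentiableOn (by simp)).differentiableAt (isOpen_upperHalfPlaneSet.mem_nhds hz)

theorem SmoothUpper.fderiv_apply {f : ℂ → ℂ} (hf : SmoothUpper f) (v : ℂ) :
    SmoothUpper fun z => fderiv ℝ f z v :=
  (hf.fderiv_of_isOpen isOpen_upperHalfPlaneSet (by simp)).clm_apply contDiffOn_const

theorem SmoothUpper.dTau {f : ℂ → ℂ} (hf : SmoothUpper f) : SmoothUpper (dTau f) :=
  ((hf.fderiv_apply 1).sub (contDiffOn_const.mul (hf.fderiv_apply I))).div_const 2

theorem SmoothUpper.dTauBar {f : ℂ → ℂ} (hf : SmoothUpper f) : SmoothUpper (dTauBar f) :=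
  ((hf.fderiv_apply 1).add (contDiffOn_const.mul (hf.fderiv_apply I))).div_const 2

theorem smoothUpper_of_differentiableOn {f : ℂ → ℂ} (hf : DifferentiableOn ℂ f upperHalfPlaneSet) :
    SmoothUpper f :=
  (hf.contDiffOn isOpen_upperHalfPlaneSet).restrict_scalars ℝ

theorem smoothUpper_tauDiff : SmoothUpper tauDiff :=
  contDiffOn_id.sub (conjCLE.contDiff.contDiffOn)

theorem tauDiff_ne_zero {z : ℂ} (hz : z ∈ upperHalfPlaneSet) : tauDiff z ≠ 0 := by
  have hz' : 0 < z.im := hz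
  intro h
  have := congrArg Complex.im h
  simp [tauDiff] at this
  linarith

theorem smoothUpper_div_tauDiff (c : ℂ) : SmoothUpper fun z => c / tauDiff z :=
  (contDiffOn_const.mul (smoothUpper_tauDiff.inv fun _ hz => tauDiff_ne_zero hz)).congr
    fun _ _ => div_eq_mul_inv c _

theorem SmoothUpper.raise {f : ℂ → ℂ} (hf : SmoothUpper f) (k : ℕ) : SmoothUpper (raise k f) :=
  hf.dTau.add ((smoothUpper_div_tauDiff _).mul hf)

theorem SmoothUpper.raiseIter {f : ℂ → ℂ} (hf : SmoothUpper f) (k : ℕ) :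
    ∀ j, SmoothUpper (raiseIter k f j)
  | 0 => hf
  | j + 1 => (SmoothUpper.raiseIter hf k j).raise _

theorem fderiv_eq_of_eqOn_upper {f g : ℂ → ℂ} (h : Set.EqOn f g upperHalfPlaneSet) {z : ℂ}
    (hz : z ∈ upperHalfPlaneSet) : fderiv ℝ f z = fderiv ℝ g z :=
  (h.eventuallyEq_of_mem (isOpen_upperHalfPlaneSet.mem_nhds hz)).fderiv_eq

theorem dTau_congr {f g : ℂ → ℂ} (h : Set.EqOn f g upperHalfPlaneSet) :
    Set.EqOn (dTau f) (dTau g) upperHalfPlaneSet := fun z hz => by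
  simp only [dTau, fderiv_eq_of_eqOn_upper h hz]

theorem dTauBar_congr {f g : ℂ → ℂ} (h : Set.EqOn f g upperHalfPlaneSet) :
    Set.EqOn (dTauBar f) (dTauBar g) upperHalfPlaneSet := fun z hz => by
  simp only [dTauBar, fderiv_eq_of_eqOn_upper h hz]

theorem dTauBar_add {f g : ℂ → ℂ} {z : ℂ} (hf : DifferentiableAt ℝ f z)
    (hg : DifferentiableAt ℝ g z) :
    dTauBar (fun w => f w + g w) z = dTauBar f z + dTauBar g z := by
  simp only [dTauBar, fderiv_fun_add hf hg, add_apply]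
  ring

theorem dTau_mul {f g : ℂ → ℂ} {z : ℂ} (hf : DifferentiableAt ℝ f z)
    (hg : DifferentiableAt ℝ g z) :
    dTau (fun w => f w * g w) z = dTau f z * g z + f z * dTau g z := by
  simp only [dTau, fderiv_fun_mul hf hg, add_apply, smul_apply, smul_eq_mul]
  ring

theorem dTauBar_mul {f g : ℂ → ℂ} {z : ℂ} (hf : DifferentiableAt ℝ f z)
    (hg : DifferentiableAt ℝ g z) :
    dTauBar (fun w => f w * g w) z = dTauBar f z * g z + f z * dTauBar g z := by
  simp only [dTauBar, fderiv_fun_mul hf hg, add_apply, smul_apply, smul_eq_mul]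
  ring

theorem dTau_const (c z : ℂ) : dTau (fun _ => c) z = 0 := by simp [dTau]

theorem dTauBar_const (c z : ℂ) : dTauBar (fun _ => c) z = 0 := by simp [dTauBar]

theorem dTauBar_const_mul (c : ℂ) {f : ℂ → ℂ} {z : ℂ} (hf : DifferentiableAt ℝ f z) :
    dTauBar (fun w => c * f w) z = c * dTauBar f z := by
  rw [dTauBar_mul (differentiableAt_const c) hf, dTauBar_const, zero_mul, zero_add]

theorem dTauBar_sum {ι : Type*} (s : Finset ι) {f : ι → ℂ → ℂ} {z : ℂ}
    (hf : ∀ i ∈ s, DifferentiableAt ℝ (f i) z) :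
    dTauBar (fun w => ∑ i ∈ s, f i w) z = ∑ i ∈ s, dTauBar (f i) z := by
  simp only [dTauBar, fderiv_fun_sum hf, sum_apply, Finset.mul_sum,
    ← Finset.sum_add_distrib, Finset.sum_div]

theorem dTauBar_eq_zero {f : ℂ → ℂ} {z : ℂ} (hf : DifferentiableAt ℂ f z) : dTauBar f z = 0 := by
  simp only [dTauBar, hf.fderiv_restrictScalars ℝ, ContinuousLinearMap.coe_restrictScalars']
  have h : fderiv ℂ f z I = I * fderiv ℂ f z 1 := by
    rw [← smul_eq_mul, ← map_smul, smul_eq_mul, mul_one]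
  rw [h, ← mul_assoc, I_mul_I]
  ring

theorem fderiv_tauDiff (z v : ℂ) : fderiv ℝ tauDiff z v = v - (starRingEnd ℂ) v := by
  have h : HasFDerivAt tauDiff (ContinuousLinearMap.id ℝ ℂ - (conjCLE : ℂ →L[ℝ] ℂ)) z :=
    (hasFDerivAt_id z).sub conjCLE.hasFDerivAt
  rw [h.fderiv]
  simp

theorem dTau_tauDiff (z : ℂ) : dTau tauDiff z = 1 := by
  simp only [dTau, fderiv_tauDiff, map_one, conj_I]
  linear_combination (-1 : ℂ) * I_mul_I

theorem dTauBar_tauDiff (z : ℂ) : dTauBar tauDiff z = -1 := by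
  simp only [dTauBar, fderiv_tauDiff, map_one, conj_I]
  linear_combination I_mul_I

theorem dTauBar_div_tauDiff (c : ℂ) {z : ℂ} (hz : z ∈ upperHalfPlaneSet) :
    dTauBar (fun w => c / tauDiff w) z = c / tauDiff z ^ 2 := by
  have h0 := tauDiff_ne_zero hz
  have h : Set.EqOn (fun w => c / tauDiff w * tauDiff w) (fun _ => c) upperHalfPlaneSet :=
    fun w hw => div_mul_cancel₀ c (tauDiff_ne_zero hw)
  have h1 := dTauBar_congr h hz
  rw [dTauBar_mul ((smoothUpper_div_tauDiff c).differentiableAt hz)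
    (smoothUpper_tauDiff.differentiableAt hz), dTauBar_const, dTauBar_tauDiff] at h1
  field_simp at h1 ⊢
  linear_combination h1

/-- The two Wirtinger derivatives commute, since the second derivative is symmetric. -/
theorem dTauBar_dTau {f : ℂ → ℂ} (hf : SmoothUpper f) {z : ℂ} (hz : z ∈ upperHalfPlaneSet) :
    dTauBar (dTau f) z = dTau (dTauBar f) z := by
  have hd : DifferentiableAt ℝ (fderiv ℝ f) z :=
    ((hf.fderiv_of_isOpen (m := (⊤ : ℕ∞)) isOpen_upperHalfPlaneSet (by simp)).differentiableOn
      (by simp)).differentiableAt (isOpen_upperHalfPlaneSet.mem_nhds hz)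
  have hsymm : IsSymmSndFDerivAt ℝ f z :=
    (hf.contDiffAt (isOpen_upperHalfPlaneSet.mem_nhds hz)).isSymmSndFDerivAt
      (by rw [minSmoothness_of_isRCLikeNormedField]; exact WithTop.coe_le_coe.2 (le_top (a := 2)))
  have hv (v : ℂ) : DifferentiableAt ℝ (fun w => fderiv ℝ f w v) z :=
    (hf.fderiv_apply v).differentiableAt hz
  have happ (v u : ℂ) : fderiv ℝ (fun w => fderiv ℝ f w v) z u = fderiv ℝ (fderiv ℝ f) z u v := by
    rw [fderiv_clm_apply hd (differentiableAt_const v)]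
    simp
  have e1 (u : ℂ) : fderiv ℝ (dTau f) z u =
      (fderiv ℝ (fderiv ℝ f) z u 1 - I * fderiv ℝ (fderiv ℝ f) z u I) / 2 := by
    have : dTau f = fun w => (2 : ℂ)⁻¹ * (fderiv ℝ f w 1 - I * fderiv ℝ f w I) := by
      funext w; simp only [dTau]; ring
    rw [this, fderiv_const_mul ((hv 1).fun_sub ((hv I).const_mul I)),
      fderiv_fun_sub (hv 1) ((hv I).const_mul I), fderiv_const_mul (hv I)]
    simp only [smul_apply, sub_apply, smul_eq_mul, happ]
    ring
  have e2 (u : ℂ) : fderiv ℝ (dTauBar f) z u =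
      (fderiv ℝ (fderiv ℝ f) z u 1 + I * fderiv ℝ (fderiv ℝ f) z u I) / 2 := by
    have : dTauBar f = fun w => (2 : ℂ)⁻¹ * (fderiv ℝ f w 1 + I * fderiv ℝ f w I) := by
      funext w; simp only [dTauBar]; ring
    rw [this, fderiv_const_mul ((hv 1).fun_add ((hv I).const_mul I)),
      fderiv_fun_add (hv 1) ((hv I).const_mul I), fderiv_const_mul (hv I)]
    simp only [smul_apply, add_apply, smul_eq_mul, happ]
    ring
  rw [dTauBar, dTau, e1, e1, e2, e2, hsymm.eq I 1]
  ring

/-! ### Raising and lowering operators -/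

/-- The lowering operator `(τ - τ̄)² ∂/∂τ̄`, from weight `k + 2` to weight `k`. -/
def lower (f : ℂ → ℂ) (z : ℂ) : ℂ := tauDiff z ^ 2 * dTauBar f z

theorem raise_const_mul (k : ℕ) (c : ℂ) {f : ℂ → ℂ} {z : ℂ} (hf : DifferentiableAt ℝ f z) :
    raise k (fun w => c * f w) z = c * raise k f z := by
  rw [raise, raise, dTau_mul (differentiableAt_const c) hf, dTau_const]
  ring

/-- The commutation relation of the lowering and raising operators: if `h` is the lowered form of
`f`, of weight `k + 2`, then lowering the raised form of `f` gives the raised form of `h` and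
`(k + 2) f`. -/
theorem lower_raise (k : ℕ) {f h : ℂ → ℂ} (hf : SmoothUpper f)
    (hfh : Set.EqOn (lower f) h upperHalfPlaneSet) :
    Set.EqOn (lower (raise (k + 2) f)) (fun z => raise k h z + (k + 2 : ℕ) * f z)
      upperHalfPlaneSet := by
  intro z hz
  have h0 := tauDiff_ne_zero hz
  have hd := smoothUpper_tauDiff.differentiableAt hz
  have hb := hf.dTauBar.differentiableAt hz
  have e1 := dTau_congr (f := fun w => tauDiff w * tauDiff w * dTauBar f w) (g := h)
    (fun w hw => by rw [← hfh hw, lower]; ring) hz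
  rw [dTau_mul (hd.fun_mul hd) hb, dTau_mul hd hd, dTau_tauDiff] at e1
  have e2 : dTauBar (raise (k + 2) f) z = dTau (dTauBar f) z +
      ((k + 2 : ℕ) : ℂ) / tauDiff z ^ 2 * f z + ((k + 2 : ℕ) : ℂ) / tauDiff z * dTauBar f z := by
    have := (smoothUpper_div_tauDiff ((k + 2 : ℕ) : ℂ)).differentiableAt hz
    change dTauBar (fun w => dTau f w + ((k + 2 : ℕ) : ℂ) / tauDiff w * f w) z = _
    rw [dTauBar_add (hf.dTau.differentiableAt hz) (this.fun_mul (hf.differentiableAt hz)),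
      dTauBar_mul this (hf.differentiableAt hz), dTauBar_div_tauDiff _ hz, dTauBar_dTau hf hz]
    ring
  simp only [lower, e2, raise, ← hfh hz, ← e1]
  push_cast
  field_simp
  ring

/-- Lowering `∂̂^{j+1} f` gives a multiple of `∂̂^j f`, provided that lowering `f` gives a constant
`c` which is annihilated by the raising operator of its weight `k`. -/
theorem lower_raiseIter_succ (k : ℕ) {f : ℂ → ℂ} (hf : SmoothUpper f) {c : ℂ}
    (hfc : Set.EqOn (lower f) (fun _ => c) upperHalfPlaneSet) (hkc : (k : ℂ) * c = 0) (j : ℕ) :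
    Set.EqOn (lower (raiseIter (k + 2) f (j + 1)))
      (fun z => ((j + 1 : ℕ) : ℂ) * ((k + 2 + j : ℕ) : ℂ) * raiseIter (k + 2) f j z)
      upperHalfPlaneSet := by
  induction j with
  | zero =>
    intro z hz
    have h := lower_raise k hf hfc hz
    simp only [raiseIter, mul_zero, add_zero, zero_add]
    rw [h]
    simp only [raise, dTau_const]
    push_cast
    linear_combination hkc / tauDiff z
  | succ j ih =>
    intro z hz
    have hs := hf.raiseIter (k + 2)
    have h := lower_raise (k + 2 * (j + 1)) (hs (j + 1)) ih hz
    rw [raiseIter, show k + 2 + 2 * (j + 1) = k + 2 * (j + 1) + 2 by ring, h]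
    beta_reduce
    rw [raise_const_mul _ _ ((hs j).differentiableAt hz),
      show k + 2 * (j + 1) = k + 2 + 2 * j by ring, ← raiseIter]
    push_cast
    ring

/-! ### The forms `g_{p,q}` -/

theorem smoothUpper_eisStar {k : ℕ} (hk : 2 ≤ k) (hk2 : Even k) : SmoothUpper (eisStar k) := by
  have h := smoothUpper_of_differentiableOn (differentiableOn_eis hk hk2)
  by_cases hk' : k = 2
  · subst hk'
    exact (h.sub (smoothUpper_div_tauDiff (2 * Real.pi * I))).congr fun z _ => if_pos rfl
  · exact h.congr fun z _ => if_neg hk'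

theorem lower_eisStar {k : ℕ} (hk : 2 ≤ k) (hk2 : Even k) {z : ℂ} (hz : z ∈ upperHalfPlaneSet) :
    lower (eisStar k) z = if k = 2 then -(2 * Real.pi * I) else 0 := by
  have h0 := tauDiff_ne_zero hz
  have hh := (differentiableOn_eis hk hk2).differentiableAt (isOpen_upperHalfPlaneSet.mem_nhds hz)
  have h := dTauBar_eq_zero hh
  rw [lower]
  by_cases hk' : k = 2
  · subst hk'
    have e : eisStar 2 = fun w => eis 2 w + -(2 * Real.pi * I) / tauDiff w := by
      funext w
      simp only [eisStar, if_true]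
      ring
    rw [e, dTauBar_add (hh.restrictScalars ℝ) ((smoothUpper_div_tauDiff _).differentiableAt hz), h,
      dTauBar_div_tauDiff _ hz, if_pos rfl]
    field_simp
    ring
  · have e : eisStar k = eis k := by
      funext w
      exact if_neg hk'
    rw [e, h, if_neg hk', mul_zero]

theorem gForm_comm (p q : ℕ) : gForm p q = gForm q p := by
  funext z
  simp only [gForm, min_comm p q, max_comm p q]

theorem smoothUpper_gForm {p q : ℕ} (h : Odd (p + q)) : SmoothUpper (gForm p q) := by
  rcases h with ⟨m, hm⟩
  refine contDiffOn_const.mul (SmoothUpper.raiseIter (contDiffOn_const.mul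
    (smoothUpper_eisStar ?_ ?_)) _ _)
  · omega
  · exact ⟨m + 1 - min p q, by omega⟩

/-- The values of the lowering operator on `g_{p,q}`: it gives `2πi p q g_{p-1,q-1}` if
`p, q ≥ 1`, it gives `-2πi` on `g_{1,0}`, and it annihilates the other `g_{p,0}`. -/
def gLower (p q : ℕ) (z : ℂ) : ℂ :=
  2 * Real.pi * I * (p * q * gForm (p - 1) (q - 1) z - if p + q = 1 then 1 else 0)

theorem lower_gForm {p q : ℕ} (h : Odd (p + q)) {z : ℂ} (hz : z ∈ upperHalfPlaneSet) :
    lower (gForm p q) z = gLower p q z := by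
  wlog hpq : q < p generalizing p q with H
  · have := H (p := q) (q := p) (by rwa [add_comm]) (by
      rcases h with ⟨m, hm⟩
      omega)
    rw [gForm_comm, this, gLower, gLower, gForm_comm, add_comm q p]
    ring
  obtain ⟨m, hm⟩ := h
  obtain ⟨k, hk⟩ : ∃ k, p = q + k + 1 := ⟨p - q - 1, by omega⟩
  have hk2 : Even (k + 2) := ⟨m + 1 - q, by omega⟩
  set f : ℂ → ℂ := fun w => (((k + 1).factorial : ℕ) : ℂ) * eisStar (k + 2) w with hf
  have hfs : SmoothUpper f := contDiffOn_const.mul (smoothUpper_eisStar (by omega) hk2)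
  have hg (i : ℕ) : gForm (i + k + 1) i = fun w => (2 * Real.pi * I) ^ i *
      raiseIter (k + 2) f i w := by
    funext w
    simp only [gForm, show min (i + k + 1) i = i by omega, show max (i + k + 1) i = i + k + 1 by
      omega, show i + k + 1 - i = k + 1 by omega, hf]
  have hlf : Set.EqOn (lower f) (fun _ => if k = 0 then -(2 * Real.pi * I) else 0)
      upperHalfPlaneSet := by
    intro w hw
    have := lower_eisStar (k := k + 2) (by omega) hk2 hw
    rw [lower] at this
    rw [lower, hf, dTauBar_const_mul _
      ((smoothUpper_eisStar (by omega) hk2).differentiableAt hw), mul_left_comm, this]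
    by_cases hk0 : k = 0 <;> simp [hk0]
  subst hk
  rw [lower, hg, dTauBar_const_mul _ ((hfs.raiseIter (k + 2) q).differentiableAt hz), mul_left_comm,
    ← lower]
  cases q with
  | zero =>
    simp only [pow_zero, one_mul, raiseIter]
    rw [hlf hz, gLower]
    by_cases hk0 : k = 0 <;> simp [hk0]
  | succ j =>
    rw [lower_raiseIter_succ k hfs hlf (by by_cases hk0 : k = 0 <;> simp [hk0]) j hz, gLower,
      show j + 1 + k + 1 - 1 = j + k + 1 by omega, add_tsub_cancel_right, hg,
      if_neg (by omega)]
    push_cast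
    ring

/-! ### Signs and degrees -/

theorem sgn_add (m n : ℤ) : sgn (m + n) = sgn m * sgn n := by
  simp [sgn, Int.negOnePow_add]

theorem sgn_zero : sgn 0 = 1 := by simp [sgn]

theorem sgn_mul_self (n : ℤ) : sgn n * sgn n = 1 := by
  rw [← sgn_add, sgn, Int.negOnePow_even _ ⟨n, rfl⟩]
  simp

theorem sgn_eq_of_even_sub {m n : ℤ} (h : Even (m - n)) : sgn m = sgn n := by
  rw [sgn, sgn, (Int.negOnePow_eq_iff m n).2 h]

theorem wdeg_cons (x : Gen) (w : List Gen) : wdeg (x :: w) = sdeg x + wdeg w := by simp [wdeg]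

theorem wdeg_append (v w : List Gen) : wdeg (v ++ w) = wdeg v + wdeg w := by simp [wdeg]

theorem wdeg_nil : wdeg [] = 0 := rfl

theorem wdeg_rotate (w : List Gen) (r : ℕ) : wdeg (w.rotate r) = wdeg w :=
  ((List.rotate_perm w r).map sdeg).sum_eq

theorem sdeg_dual (x : Gen) : sdeg (dual x) = -1 - sdeg x := by cases x <;> rfl

theorem dual_dual (x : Gen) : dual (dual x) = x := by cases x <;> rfl

theorem pairGen_dual_mul_self (x : Gen) : pairGen x (dual x) * pairGen x (dual x) = 1 := by
  cases x <;> simp [pairGen, dual]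

theorem pairGen_dual_comm (x : Gen) : pairGen (dual x) x = -pairGen x (dual x) := by
  cases x <;> simp [pairGen, dual]

theorem pairing_vec (v : Alg) (y : Gen) : pairing v (vec y) = v (dual y) * pairGen (dual y) y := by
  rw [pairing, Finset.sum_eq_single (dual y)]
  · rw [Finset.sum_eq_single y] <;> simp +contextual [vec]
  · intro x _ hx
    refine Finset.sum_eq_zero fun z _ => ?_
    by_cases hz : z = y
    · subst hz
      have : pairGen x z = 0 := by revert hx; cases x <;> cases z <;> simp [pairGen, dual]
      rw [this, mul_zero]
    · simp [vec, hz]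
  · simp

/-! ### Cochains and their values on words -/

theorem onWord_add (f g : Cochain) (w : List Gen) :
    (f + g).onWord w = f.onWord w + g.onWord w := rfl

theorem onWord_sub (f g : Cochain) (w : List Gen) :
    (f - g).onWord w = f.onWord w - g.onWord w := rfl

theorem onWord_smul (c : ℂ) (f : Cochain) (w : List Gen) :
    (c • f).onWord w = c • f.onWord w := rfl

/-- A cochain is determined by its values on words of basis vectors. -/
theorem cochain_ext {f g : Cochain} (h : ∀ w, f.onWord w = g.onWord w) : f = g := by
  funext k
  refine Module.Basis.ext_multilinear (fun _ => Pi.basisFun ℂ Gen) fun v => ?_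
  have hw : (List.ofFn v).length = k := List.length_ofFn
  have key (F : Cochain) : F k (fun i => vec (v i)) = F.onWord (List.ofFn v) := by
    have (m : ℕ) (hm : m = k) (u : Fin m → Gen) (hu : ∀ i, u i = v (Fin.cast hm i)) :
        F k (fun i => vec (v i)) = F m (fun i => vec (u i)) := by
      subst hm
      congr
      funext i
      rw [hu]
      rfl
    exact this _ hw _ fun i => by simp [Fin.cast]
  have := (key f).trans ((h _).trans (key g).symm)
  simpa [vec] using this

theorem circ_onWord (p : ℤ) (f g : Cochain) (w : List Gen) (x : Gen) :
    (circ p f g).onWord w x = ∑ j ∈ Finset.range (w.length + 1), ∑ i ∈ Finset.range (j + 1),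
      sgn (p * wdeg (w.take i)) *
        ∑ b : Gen, g.onWord ((w.take j).drop i) b * f.onWord (w.take i ++ b :: w.drop j) x := by
  rw [circ, onWord_ofWords]
  simp only [smul_eq_mul, Finset.sum_apply, Pi.smul_apply]

theorem onWord_ofTensor (c : List Gen → ℂ) (w : List Gen) (x : Gen) :
    (ofTensor c).onWord w x = pairGen x (dual x) * c (w ++ [dual x]) := by
  rw [ofTensor, onWord_ofWords]

theorem pairing_onWord_ofTensor (c : List Gen → ℂ) (w : List Gen) (y : Gen) :
    pairing ((ofTensor c).onWord w) (vec y) = c (w ++ [y]) := by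
  rw [pairing_vec, onWord_ofTensor, dual_dual]
  have := pairGen_dual_mul_self (dual y)
  rw [dual_dual] at this
  linear_combination c (w ++ [y]) * this

/-! ### Cyclic tensors -/

/-- Invariance of a function on words under cyclic rotation, up to the Koszul sign. -/
def IsCyclicTensor (c : List Gen → ℂ) : Prop :=
  ∀ (x : Gen) (v : List Gen), c (x :: v) = sgn (sdeg x * wdeg v) * c (v ++ [x])

theorem IsCyclicTensor.append {c : List Gen → ℂ} (hc : IsCyclicTensor c) (u v : List Gen) :
    c (u ++ v) = sgn (wdeg u * wdeg v) * c (v ++ u) := by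
  induction u generalizing v with
  | nil => simp [wdeg_nil, sgn_zero]
  | cons x u ih =>
    rw [List.cons_append, hc, List.append_assoc, ih, List.append_assoc, ← mul_assoc, ← sgn_add]
    congr 1
    refine sgn_eq_of_even_sub ⟨sdeg x * wdeg u, ?_⟩
    simp only [wdeg_append, wdeg_cons, wdeg_nil]
    ring

theorem IsCyclicTensor.isCyclic_ofTensor {c : List Gen → ℂ} (hc : IsCyclicTensor c) :
    IsCyclic (ofTensor c) := by
  intro x y w
  rw [pairing_onWord_ofTensor, pairing_onWord_ofTensor, List.cons_append, hc, wdeg_append,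
    wdeg_cons, wdeg_nil, add_zero]

theorem IsCyclicTensor.const_mul {c : List Gen → ℂ} (hc : IsCyclicTensor c) (k : ℂ) :
    IsCyclicTensor fun w => k * c w := fun x v => by
  beta_reduce
  rw [hc x v]
  ring

theorem isCyclicTensor_cyclicSum (c : List Gen → ℂ) : IsCyclicTensor (cyclicSum c) := by
  intro x v
  have hlen : (x :: v).length = v.length + 1 := rfl
  have hlen' : (v ++ [x]).length = v.length + 1 := by simp
  rw [cyclicSum, cyclicSum, hlen, hlen', Finset.sum_range_succ', Finset.sum_range_succ, mul_add,
    Finset.mul_sum]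
  congr 1
  · refine Finset.sum_congr rfl fun r hr => ?_
    have hr' : r < v.length := Finset.mem_range.1 hr
    rw [List.rotate_cons_succ, List.take_succ_cons, List.drop_succ_cons,
      List.take_append_of_le_length hr'.le, List.drop_append_of_le_length hr'.le, ← mul_assoc,
      ← sgn_add]
    congr 1
    refine sgn_eq_of_even_sub ⟨-(sdeg x * wdeg (v.take r)), ?_⟩
    have : wdeg v = wdeg (v.take r) + wdeg (v.drop r) := by
      rw [← wdeg_append, List.take_append_drop]
    simp only [wdeg_append, wdeg_cons, wdeg_nil, this]
    ring
  · simp only [List.take_zero, wdeg_nil, zero_mul, sgn_zero, one_mul, List.rotate_zero,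
      List.take_left', List.drop_left', wdeg_cons, add_zero, List.rotate_append_length_eq]
    rw [← mul_assoc, mul_comm (wdeg v), sgn_mul_self, one_mul]
    rfl

theorem cyclicSum_finsetSum {ι : Type*} (s : Finset ι) (c : ι → List Gen → ℂ) (w : List Gen) :
    cyclicSum (fun v => ∑ i ∈ s, c i v) w = ∑ i ∈ s, cyclicSum (c i) w := by
  simp only [cyclicSum, Finset.mul_sum]
  exact Finset.sum_comm

theorem cyclicSum_add (f g : List Gen → ℂ) (u : List Gen) :
    cyclicSum (fun w => f w + g w) u = cyclicSum f u + cyclicSum g u := by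
  simp only [cyclicSum, mul_add, Finset.sum_add_distrib]

theorem cyclicSum_const_mul (k : ℂ) (c : List Gen → ℂ) (w : List Gen) :
    cyclicSum (fun v => k * c v) w = k * cyclicSum c w := by
  simp only [cyclicSum, Finset.mul_sum]
  exact Finset.sum_congr rfl fun r _ => by ring

theorem exists_rotate_of_cyclicSum_ne_zero {c : List Gen → ℂ} {w : List Gen}
    (h : cyclicSum c w ≠ 0) : ∃ r, c (w.rotate r) ≠ 0 := by
  obtain ⟨r, _, hr⟩ := Finset.exists_ne_zero_of_sum_ne_zero h
  exact ⟨r, right_ne_zero_of_mul hr⟩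

/-- The signed number of rotations which carry the word `u` to the word `v`. -/
def rotCount (v u : List Gen) : ℂ := cyclicSum (fun w => if w = v then 1 else 0) u

theorem exists_rotate_of_rotCount_ne_zero {v u : List Gen} (h : rotCount v u ≠ 0) :
    ∃ r, u.rotate r = v := by
  obtain ⟨r, hr⟩ := exists_rotate_of_cyclicSum_ne_zero h
  exact ⟨r, by_contra fun h' => hr (if_neg h')⟩

theorem rotCount_eq_zero_of_length_ne {v u : List Gen} (h : u.length ≠ v.length) :
    rotCount v u = 0 := by
  by_contra h0
  obtain ⟨r, rfl⟩ := exists_rotate_of_rotCount_ne_zero h0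
  exact h (List.length_rotate u r).symm

theorem rotCount_comm (v u : List Gen) : rotCount v u = rotCount u v := by
  by_cases hl : u.length = v.length
  swap
  · rw [rotCount_eq_zero_of_length_ne hl, rotCount_eq_zero_of_length_ne (Ne.symm hl)]
  -- the rotation by `r` is undone by the rotation by `n - r`
  have key (u v : List Gen) (r : ℕ) (hr : r < u.length) (h : u.rotate r = v) :
      v.rotate ((u.length - r) % u.length) = u ∧
        wdeg (v.take ((u.length - r) % u.length)) * wdeg (v.drop ((u.length - r) % u.length)) =
          wdeg (u.take r) * wdeg (u.drop r) := by
    rcases Nat.eq_zero_or_pos r with rfl | hr0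
    · rw [List.rotate_zero] at h
      subst h
      simp
    · rw [Nat.mod_eq_of_lt (by omega)]
      subst h
      refine ⟨?_, ?_⟩
      · rw [List.rotate_rotate, Nat.add_sub_cancel' hr.le, List.rotate_length]
      · rw [List.rotate_eq_drop_append_take hr.le, List.take_left' (by simp),
          List.drop_left' (by simp), mul_comm]
  have hinv (n r : ℕ) (hr : r < n) : (n - (n - r) % n) % n = r := by
    rcases Nat.eq_zero_or_pos r with rfl | hr0
    · simp
    · rw [Nat.mod_eq_of_lt (by omega : n - r < n), Nat.mod_eq_of_lt (by omega)]
      omega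
  simp only [rotCount, cyclicSum]
  refine Finset.sum_nbij' (fun r => (u.length - r) % u.length) (fun r => (u.length - r) % u.length)
    ?_ ?_ ?_ ?_ ?_
  · intro r hr
    rw [Finset.mem_range] at hr ⊢
    rw [← hl]
    exact Nat.mod_lt _ (by omega)
  · intro r hr
    rw [Finset.mem_range] at hr ⊢
    exact Nat.mod_lt _ (by omega)
  · intro r hr
    exact hinv _ _ (Finset.mem_range.1 hr)
  · intro r hr
    exact hinv _ _ (hl ▸ Finset.mem_range.1 hr)
  · intro r hr
    rw [Finset.mem_range] at hr
    by_cases h : u.rotate r = v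
    · obtain ⟨h1, h2⟩ := key u v r hr h
      rw [if_pos h, if_pos h1, h2]
    · rw [if_neg h, if_neg, mul_zero, mul_zero]
      intro h'
      have := (key v u ((u.length - r) % u.length) (hl ▸ Nat.mod_lt _ (by omega)) h').1
      rw [← hl, hinv _ _ hr] at this
      exact h this

/-- Rotating the target word changes the count by the Koszul sign. -/
theorem rotCount_append (α β u : List Gen) :
    rotCount (α ++ β) u = sgn (wdeg α * wdeg β) * rotCount (β ++ α) u := by
  rw [rotCount_comm, rotCount_comm (β ++ α)]
  exact (isCyclicTensor_cyclicSum _).append α β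

/-! ### The bracket of a cyclic cochain with a cyclic ternary cochain -/

/-- Replaces the first three letters of a word by the value of a cochain on them, and evaluates a
function on words at the result. Summed over the rotations of a cyclic word, this is the action of
a ternary cochain on the tensor of a cyclic cochain. -/
def contractHead (g : Cochain) (T : List Gen → ℂ) (w : List Gen) : ℂ :=
  ∑ b, g.onWord (w.take 3) b * T (b :: w.drop 3)

theorem sum_comp_dual (f : Gen → ℂ) : ∑ b, f (dual b) = ∑ b, f b :=
  Equiv.sum_comp (⟨dual, dual, dual_dual, dual_dual⟩ : Gen ≃ Gen) f

/-- The signs in the comparison of `ψ(…, μ(…), …)` with the contraction of a three-letter subword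
which crosses the end of a cyclic word. -/
theorem sum_insert_eq_contract {T Ψ : List Gen → ℂ} (hT : IsCyclicTensor T) (hΨ : IsCyclicTensor Ψ)
    (hTdeg : ∀ w, T w ≠ 0 → wdeg w = -2) (hΨdeg : ∀ w, Ψ w ≠ 0 → wdeg w = -1)
    (α β γ : List Gen) (y : Gen) :
    -(sgn (wdeg α) * ∑ b, (ofTensor T).onWord β b * Ψ (α ++ b :: γ ++ [y])) =
      sgn (wdeg (α ++ β) * wdeg (γ ++ [y])) *
        ∑ b, (ofTensor Ψ).onWord (γ ++ [y] ++ α) b * T (b :: β) := by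
  rw [← sum_comp_dual, Finset.mul_sum, Finset.mul_sum, ← Finset.sum_neg_distrib]
  refine Finset.sum_congr rfl fun b _ => ?_
  rw [onWord_ofTensor, onWord_ofTensor, dual_dual, pairGen_dual_comm]
  have h1 : T (β ++ [b]) = sgn (sdeg b * wdeg β) * T (b :: β) := by
    rw [hT b β, ← mul_assoc, sgn_mul_self, one_mul]
  have h2 : Ψ (α ++ dual b :: γ ++ [y]) =
      sgn (wdeg (α ++ [dual b]) * wdeg (γ ++ [y])) * Ψ (γ ++ [y] ++ α ++ [dual b]) := by
    have := hΨ.append (α ++ [dual b]) (γ ++ [y])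
    simpa only [List.append_assoc, List.cons_append, List.nil_append] using this
  rw [h1, h2]
  by_cases hT0 : T (b :: β) = 0
  · simp [hT0]
  by_cases hΨ0 : Ψ (γ ++ [y] ++ α ++ [dual b]) = 0
  · rw [hΨ0]
    ring
  have d1 := hTdeg _ hT0
  have d2 := hΨdeg _ hΨ0
  have hs : sgn (wdeg α) * sgn (sdeg b * wdeg β) *
      sgn (wdeg (α ++ [dual b]) * wdeg (γ ++ [y])) = sgn (wdeg (α ++ β) * wdeg (γ ++ [y])) := by
    rw [← sgn_add, ← sgn_add]
    refine sgn_eq_of_even_sub ?_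
    simp only [wdeg_append, wdeg_cons, wdeg_nil, sdeg_dual, add_zero] at d1 d2 ⊢
    have e1 : wdeg γ = sdeg b - sdeg y - wdeg α := by linarith
    have e2 : wdeg β = -2 - sdeg b := by linarith
    rw [e1, e2]
    obtain ⟨m, hm⟩ := Int.even_mul_succ_self (sdeg b)
    exact ⟨-m, by linear_combination -hm⟩
  linear_combination (pairGen b (dual b) * T (b :: β) * Ψ (γ ++ [y] ++ α ++ [dual b])) * hs

/-- The tensor of the bracket of the cochain of a cyclic tensor `T` with the cochain of a cyclic
tensor `Ψ` of four letters: each of the three-letter subwords of a cyclic word is replaced by the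
value of `Ψ` on it. The subwords which avoid the last letter come from `T ∘ Ψ`, the others from
`Ψ ∘ T`. -/
theorem bracket_ofTensor {T Ψ : List Gen → ℂ} (hT : IsCyclicTensor T) (hΨ : IsCyclicTensor Ψ)
    (hTdeg : ∀ w, T w ≠ 0 → wdeg w = -2) (hΨdeg : ∀ w, Ψ w ≠ 0 → wdeg w = -1)
    (hΨlen : ∀ w, Ψ w ≠ 0 → w.length = 4) (w : List Gen) (x : Gen) :
    (bracket 2 1 (ofTensor T) (ofTensor Ψ)).onWord w x =
      pairGen x (dual x) * cyclicSum (contractHead (ofTensor Ψ) T) (w ++ [dual x]) := by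
  set y := dual x with hy
  set n := w.length with hn
  set g := ofTensor Ψ with hg
  have hg0 (v : List Gen) (b : Gen) (h : v.length ≠ 3) : g.onWord v b = 0 := by
    rw [hg, onWord_ofTensor]
    by_contra h0
    have := hΨlen _ (right_ne_zero_of_mul h0)
    simp at this
    omega
  set X : ℕ → ℂ := fun r => sgn (wdeg ((w ++ [y]).take r) * wdeg ((w ++ [y]).drop r)) *
    contractHead g T ((w ++ [y]).rotate r) with hX
  have hrot (r : ℕ) (hr : r ≤ n) : (w ++ [y]).rotate r = w.drop r ++ [y] ++ w.take r := by
    rw [List.rotate_eq_drop_append_take (by simp; omega), List.drop_append_of_le_length hr,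
      List.take_append_of_le_length hr]
  have hXsmall (hn2 : n < 2) (r : ℕ) : X r = 0 := by
    simp only [hX, contractHead]
    rw [Finset.sum_eq_zero, mul_zero]
    intro b _
    rw [hg0, zero_mul]
    simp
    omega
  -- the subwords which avoid the last letter
  have h1 : (circ 0 (ofTensor T) g).onWord w x =
      pairGen x y * ∑ r ∈ Finset.range (n + 1), if r + 3 ≤ n then X r else 0 := by
    rw [circ_onWord, Finset.sum_comm' (t' := Finset.range (n + 1))
      (s' := fun i => Finset.Ico i (n + 1)) (by
        intro j i
        simp only [Finset.mem_range, Finset.mem_Ico]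
        omega), Finset.mul_sum]
    refine Finset.sum_congr rfl fun i hi => ?_
    by_cases h3 : i + 3 ≤ n
    · rw [if_pos h3, Finset.sum_eq_single (i + 3)]
      · simp only [hX, contractHead]
        rw [hrot i (by omega), zero_mul, sgn_zero, one_mul]
        have ht : (w.drop i ++ [y] ++ w.take i).take 3 = (w.take (i + 3)).drop i := by
          rw [List.append_assoc, List.take_append_of_le_length (by simp; omega), List.drop_take,
            Nat.add_sub_cancel_left]
        have hd : (w.drop i ++ [y] ++ w.take i).drop 3 = w.drop (i + 3) ++ [y] ++ w.take i := by
          rw [List.append_assoc, List.drop_append_of_le_length (by simp; omega), List.drop_drop,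
            List.append_assoc]
        rw [ht, hd, Finset.mul_sum, Finset.mul_sum]
        refine Finset.sum_congr rfl fun b _ => ?_
        by_cases hz : g.onWord ((w.take (i + 3)).drop i) b = 0
        · simp [hz]
        have hdeg : wdeg ((w.take (i + 3)).drop i) = sdeg b := by
          rw [hg, onWord_ofTensor] at hz
          have := hΨdeg _ (right_ne_zero_of_mul hz)
          rw [wdeg_append, wdeg_cons, wdeg_nil, sdeg_dual] at this
          linarith
        have hw : w.drop i = (w.take (i + 3)).drop i ++ w.drop (i + 3) := by
          rw [List.drop_take, Nat.add_sub_cancel_left, ← List.drop_drop, List.take_append_drop]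
        rw [onWord_ofTensor T, List.append_assoc, hT.append,
          List.take_append_of_le_length (by omega), List.drop_append_of_le_length (by omega), hw]
        simp only [wdeg_append, wdeg_cons, hdeg, List.cons_append, List.append_assoc, ← hy]
        ring_nf
      · intro j hj hne
        rw [Finset.sum_eq_zero, mul_zero]
        intro b _
        rw [hg0, zero_mul]
        simp only [Finset.mem_Ico, List.length_drop, List.length_take] at hj ⊢
        omega
      · intro h
        simp only [Finset.mem_Ico] at h
        omega
    · rw [if_neg h3, mul_zero]
      refine Finset.sum_eq_zero fun j hj => ?_
      rw [Finset.sum_eq_zero, mul_zero]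
      intro b _
      rw [hg0, zero_mul]
      simp only [Finset.mem_Ico, List.length_drop, List.length_take] at hj ⊢
      omega
  -- the subwords which contain the last letter
  have h2 : -(circ 1 g (ofTensor T)).onWord w x =
      pairGen x y * ∑ r ∈ Finset.range (n + 1), if r + 3 ≤ n then 0 else X r := by
    rw [circ_onWord, Finset.mul_sum, ← Finset.sum_neg_distrib]
    refine Finset.sum_congr rfl fun j hj => ?_
    have hj' : j ≤ n := Nat.lt_succ_iff.1 (Finset.mem_range.1 hj)
    have hzero (i : ℕ) (hi : i ≤ j) (h : i + n ≠ j + 2) : sgn (1 * wdeg (w.take i)) *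
        ∑ b, (ofTensor T).onWord ((w.take j).drop i) b * g.onWord (w.take i ++ b :: w.drop j) x
        = 0 := by
      rw [Finset.sum_eq_zero, mul_zero]
      intro b _
      rw [hg0, mul_zero]
      simp only [List.length_append, List.length_take, List.length_cons, List.length_drop]
      omega
    by_cases h3 : n < 2 ∨ j + 3 ≤ n
    · have hR : (if j + 3 ≤ n then 0 else X j) = 0 := by
        rcases h3 with h3 | h3
        · rw [hXsmall h3, ite_self]
        · rw [if_pos h3]
      rw [hR, mul_zero, Finset.sum_eq_zero, neg_zero]
      intro i hi
      refine hzero i (Nat.lt_succ_iff.1 (Finset.mem_range.1 hi)) ?_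
      have := Finset.mem_range.1 hi
      omega
    · rw [if_neg (by omega), Finset.sum_eq_single (j + 2 - n)]
      · set i := j + 2 - n with hi
        have hw : w.take j = w.take i ++ (w.take j).drop i := by
          conv_lhs => rw [← List.take_append_drop i (w.take j)]
          rw [List.take_take, min_eq_left (by omega)]
        have ht : (w.drop j ++ [y] ++ w.take j).take 3 = w.drop j ++ [y] ++ w.take i := by
          rw [List.take_append, List.take_of_length_le (by simp; omega), List.take_take]
          congr 2
          simp
          omega
        have hd : (w.drop j ++ [y] ++ w.take j).drop 3 = (w.take j).drop i := by
          rw [List.drop_append, List.drop_of_length_le (by simp; omega), List.nil_append]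
          congr 1
          simp
          omega
        have key := sum_insert_eq_contract hT hΨ hTdeg hΨdeg (w.take i) ((w.take j).drop i)
          (w.drop j) y
        rw [← hw] at key
        simp only [hX, contractHead]
        rw [hrot j hj', ht, hd, List.take_append_of_le_length hj',
          List.drop_append_of_le_length hj', ← key, one_mul]
        simp only [onWord_ofTensor, hg, ← hy, Finset.mul_sum, mul_neg]
        congr 1
        refine Finset.sum_congr rfl fun b _ => ?_
        ring
      · intro i hi hne
        have := Finset.mem_range.1 hi
        exact hzero i (by omega) (by omega)
      · intro h
        simp only [Finset.mem_range] at h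
        omega
  have h3 : cyclicSum (contractHead g T) (w ++ [y]) = ∑ r ∈ Finset.range (n + 1), X r := by
    rw [cyclicSum]
    simp [hX, hn]
  rw [bracket, onWord_sub, onWord_smul, Pi.sub_apply, Pi.smul_apply, h3]
  simp only [sub_self, mul_zero, sgn_zero, one_smul]
  rw [show (2 : ℤ) - 1 = 1 by norm_num, sub_eq_add_neg, h1, h2, ← mul_add,
    ← Finset.sum_add_distrib]
  congr 1
  refine Finset.sum_congr rfl fun r _ => ?_
  split_ifs <;> simp

/-! ### Integral structure constants -/

/-- The sign `(-1)^n` as an integer. -/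
def sgnInt (n : ℤ) : ℤ := if n % 2 = 0 then 1 else -1

theorem sgn_eq_sgnInt (n : ℤ) : sgn n = (sgnInt n : ℂ) := by
  rw [sgn, sgnInt]
  split_ifs with h
  · rw [Int.negOnePow_even n (Int.even_iff.2 h)]
    rfl
  · rw [Int.negOnePow_odd n (Int.odd_iff.2 (by omega))]
    rfl

/-- The integer `⟨x, dual x⟩`. -/
def pairInt : Gen → ℤ
  | .idO | .idL | .theta => 1
  | .xi | .xiL | .eta => -1

theorem pairGen_dual (x : Gen) : pairGen x (dual x) = (pairInt x : ℂ) := by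
  cases x <;> simp [pairGen, dual, pairInt]

/-- `rotCount` as an integer. -/
def rotCountInt (v u : List Gen) : ℤ :=
  ((List.range u.length).map fun r =>
    if u.rotate r = v then sgnInt (wdeg (u.take r) * wdeg (u.drop r)) else 0).sum

theorem rotCount_eq_rotCountInt (v u : List Gen) : rotCount v u = (rotCountInt v u : ℂ) := by
  rw [rotCount, cyclicSum, rotCountInt, ← List.sum_toFinset _ List.nodup_range, List.toFinset_range]
  push_cast
  refine Finset.sum_congr rfl fun r _ => ?_
  split_ifs <;> simp [sgn_eq_sgnInt]

/-- The structure constants of `ψ_3`, up to the common factor `-(1/2πi) (τ-τ̄)^{-2}`. -/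
def psiInt (w : List Gen) : Gen → ℤ
  | .theta => if w = [.xi, .theta, .xiL] then 1 else 0
  | .eta => if w = [.xiL, .eta, .xi] then -1 else 0
  | .idO => if w = [.theta, .xiL, .eta] then 1 else 0
  | .idL => if w = [.eta, .xi, .theta] then 1 else 0
  | _ => 0

theorem psiInt_eq_zero {w : List Gen} (h : w.length ≠ 3) (b : Gen) : psiInt w b = 0 := by
  have key (x y z : Gen) : w ≠ [x, y, z] := by
    rintro rfl
    exact h rfl
  cases b <;> simp [psiInt, key]

/-- The structure constants of `μ_2`. -/
def mu2Int : List Gen → Gen → ℤ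
  | [.idO, .idO], .idO => -1
  | [.idO, .xi], .xi => -1
  | [.xi, .idO], .xi => 1
  | [.idO, .theta], .theta => -1
  | [.theta, .idL], .theta => -1
  | [.idL, .idL], .idL => -1
  | [.idL, .xiL], .xiL => -1
  | [.xiL, .idL], .xiL => 1
  | [.idL, .eta], .eta => -1
  | [.eta, .idO], .eta => 1
  | [.theta, .eta], .xi => -1
  | [.eta, .theta], .xiL => 1
  | _, _ => 0

theorem mu2_onWord (w : List Gen) (x : Gen) : mu2.onWord w x = (mu2Int w x : ℂ) := by
  rw [mu2, onWord_ofWords]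
  match w with
  | [] => simp [mu2Int]
  | [_] => simp [mu2Int]
  | _ :: _ :: _ :: _ => simp [mu2Int]
  | [y, z] =>
    simp only [sgn_eq_sgnInt]
    cases y <;> cases z <;> cases x <;> simp [yoneda, mu2Int, vec, sgnInt, sdeg, deg]

/-- The common factor `-(1/2πi) (τ-τ̄)^{-2}` of the structure constants of `ψ_3`. -/
def psiScale (z : ℂ) : ℂ := -(1 / (2 * Real.pi * I)) * (1 / tauDiff z ^ 2)

/-- The cyclic tensor of `ψ_3`. -/
def psiTensor (z : ℂ) (w : List Gen) : ℂ := psiScale z * rotCount [.xi, .theta, .xiL, .eta] w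

theorem psi3_eq (z : ℂ) : psi3 z = ofTensor (psiTensor z) := by
  rw [psi3]
  congr 1
  funext w
  rw [psiTensor, rotCount, ← cyclicSum_const_mul]
  congr 1
  funext v
  simp [pairGen, psiScale]

theorem isCyclicTensor_psiTensor (z : ℂ) : IsCyclicTensor (psiTensor z) :=
  (isCyclicTensor_cyclicSum _).const_mul _

theorem wdeg_of_psiTensor_ne_zero {z : ℂ} {w : List Gen} (h : psiTensor z w ≠ 0) :
    wdeg w = -1 := by
  obtain ⟨r, hr⟩ := exists_rotate_of_rotCount_ne_zero (right_ne_zero_of_mul h)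
  rw [← wdeg_rotate w r, hr]
  rfl

theorem length_of_psiTensor_ne_zero {z : ℂ} {w : List Gen} (h : psiTensor z w ≠ 0) :
    w.length = 4 := by
  obtain ⟨r, hr⟩ := exists_rotate_of_rotCount_ne_zero (right_ne_zero_of_mul h)
  rw [← List.length_rotate w r, hr]
  rfl

set_option maxRecDepth 10000 in
theorem pairInt_mul_rotCountInt_eq_psiInt : ∀ x y z b : Gen,
    pairInt b * rotCountInt [.xi, .theta, .xiL, .eta] [x, y, z, dual b] = psiInt [x, y, z] b := by
  decide +kernel

theorem psi3_onWord (z : ℂ) (w : List Gen) (b : Gen) :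
    (psi3 z).onWord w b = psiScale z * (psiInt w b : ℂ) := by
  rw [psi3_eq, onWord_ofTensor, psiTensor, mul_left_comm]
  congr 1
  by_cases h : w.length = 3
  · obtain ⟨x, y, t, rfl⟩ := List.length_eq_three.1 h
    rw [pairGen_dual, rotCount_eq_rotCountInt, ← pairInt_mul_rotCountInt_eq_psiInt]
    push_cast
    rfl
  · rw [rotCount_eq_zero_of_length_ne (by simpa using h), psiInt_eq_zero h, mul_zero, Int.cast_zero]

/-- The cyclic tensor of `μ_2`. -/
def mu2Tensor (w : List Gen) : ℂ :=
  -rotCount [.idO, .idO, .xi] w - rotCount [.idL, .idL, .xiL] w + rotCount [.theta, .eta, .idO] w -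
    rotCount [.eta, .theta, .idL] w

set_option maxRecDepth 10000 in
theorem mu2Int_eq_pairInt_mul : ∀ x y b : Gen, mu2Int [x, y] b = pairInt b *
    (-rotCountInt [.idO, .idO, .xi] [x, y, dual b] - rotCountInt [.idL, .idL, .xiL] [x, y, dual b] +
      rotCountInt [.theta, .eta, .idO] [x, y, dual b] -
      rotCountInt [.eta, .theta, .idL] [x, y, dual b]) := by
  decide +kernel

theorem mu2_eq : mu2 = ofTensor mu2Tensor := by
  refine cochain_ext fun w => funext fun b => ?_
  rw [mu2_onWord, onWord_ofTensor, mu2Tensor]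
  by_cases h : w.length = 2
  · obtain ⟨x, y, rfl⟩ := List.length_eq_two.1 h
    simp only [pairGen_dual, rotCount_eq_rotCountInt, mu2Int_eq_pairInt_mul, List.cons_append,
      List.nil_append]
    push_cast
    rfl
  · have h0 (x y z : Gen) : rotCount [x, y, z] (w ++ [dual b]) = 0 :=
      rotCount_eq_zero_of_length_ne (by simpa using h)
    have h1 : mu2Int w b = 0 := by
      match w with
      | [] => rfl
      | [_] => simp [mu2Int]
      | [_, _] => exact absurd rfl h
      | _ :: _ :: _ :: _ => simp [mu2Int]
    simp [h0, h1]

theorem isCyclicTensor_mu2Tensor : IsCyclicTensor mu2Tensor := by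
  intro x v
  simp only [mu2Tensor, rotCount, isCyclicTensor_cyclicSum _ x v]
  ring

theorem wdeg_of_mu2Tensor_ne_zero {w : List Gen} (h : mu2Tensor w ≠ 0) : wdeg w = -2 := by
  by_contra h0
  have key (v : List Gen) (hv : wdeg v = -2) : rotCount v w = 0 := by
    by_contra h1
    obtain ⟨r, rfl⟩ := exists_rotate_of_rotCount_ne_zero h1
    exact h0 (wdeg_rotate w r ▸ hv)
  apply h
  rw [mu2Tensor, key _ rfl, key _ rfl, key _ rfl, key _ rfl]
  ring

/-! ### The derivation attached to `ψ_3` -/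

/-- The sum of the values of `R` at the words obtained from `v` by replacing one of the letters `b`
by the word `s`. -/
def insertSum (s : List Gen) (b : Gen) (R : List Gen → ℂ) (v : List Gen) : ℂ :=
  ∑ i ∈ Finset.range v.length,
    if v[i]? = some b then R (v.take i ++ s ++ v.drop (i + 1)) else 0

theorem insertSum_nil (s : List Gen) (b : Gen) (R : List Gen → ℂ) : insertSum s b R [] = 0 := rfl

theorem insertSum_cons (s : List Gen) (b : Gen) (R : List Gen → ℂ) (x : Gen) (v : List Gen) :
    insertSum s b R (x :: v) =
      (if x = b then R (s ++ v) else 0) + insertSum s b (fun w => R (x :: w)) v := by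
  rw [insertSum, List.length_cons, Finset.sum_range_succ', add_comm]
  congr 1
  simp

theorem insertSum_replicate_append (s : List Gen) {b x : Gen} (h : x ≠ b) (R : List Gen → ℂ)
    (n : ℕ) (v : List Gen) : insertSum s b R (List.replicate n x ++ v) =
      insertSum s b (fun w => R (List.replicate n x ++ w)) v := by
  induction n generalizing R with
  | zero => rfl
  | succ n ih =>
    rw [List.replicate_succ, List.cons_append, insertSum_cons, if_neg h, zero_add, ih]
    rfl

/-- Contracting a subword `s` to a letter `b` in `u` and counting the rotations to `v` amounts to
counting the rotations from `u` to the words obtained from `v` by expanding a letter `b` to `s`. -/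
theorem cyclicSum_contract_rotCount {s : List Gen} {b : Gen} (hs : s.length = 3)
    (hsb : wdeg s = sdeg b) (v u : List Gen) :
    cyclicSum (fun w => if w.take 3 = s then rotCount v (b :: w.drop 3) else 0) u =
      insertSum s b (fun w => rotCount w u) v := by
  have h (w : List Gen) : (if w.take 3 = s then rotCount v (b :: w.drop 3) else 0) =
      ∑ i ∈ Finset.range v.length, if v[i]? = some b then
        sgn (wdeg (v.take i) * wdeg (v.drop i)) *
          (if w = s ++ v.drop (i + 1) ++ v.take i then 1 else 0) else 0 := by
    by_cases hw : w.take 3 = s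
    · rw [if_pos hw, rotCount_comm, rotCount, cyclicSum]
      refine Finset.sum_congr rfl fun i hi => ?_
      have hi' : i < v.length := Finset.mem_range.1 hi
      have e : v.rotate i = v[i] :: (v.drop (i + 1) ++ v.take i) := by
        rw [List.rotate_eq_drop_append_take hi'.le, List.drop_eq_getElem_cons hi', List.cons_append]
      have e' : w = s ++ v.drop (i + 1) ++ v.take i ↔ v.drop (i + 1) ++ v.take i = w.drop 3 := by
        conv_lhs =>
          rw [← List.take_append_drop 3 w, hw, List.append_assoc, List.append_cancel_left_eq]
        exact eq_comm
      rw [e, List.getElem?_eq_getElem hi']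
      simp only [List.cons.injEq, Option.some.injEq, e']
      by_cases hb : v[i] = b <;> simp [hb]
    · rw [if_neg hw]
      refine (Finset.sum_eq_zero fun i _ => ?_).symm
      have : w ≠ s ++ v.drop (i + 1) ++ v.take i := by
        rintro rfl
        rw [List.append_assoc, List.take_left' hs] at hw
        exact hw rfl
      rw [if_neg this, mul_zero, ite_self]
  simp only [h]
  rw [cyclicSum_finsetSum, insertSum]
  refine Finset.sum_congr rfl fun i hi => ?_
  have hi' : i < v.length := Finset.mem_range.1 hi
  split_ifs with hb
  · rw [cyclicSum_const_mul]
    change _ * rotCount _ u = _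
    rw [rotCount_append, ← mul_assoc, ← sgn_add, List.append_assoc]
    rw [List.getElem?_eq_getElem hi', Option.some.injEq] at hb
    have e : wdeg (v.drop i) = wdeg (s ++ v.drop (i + 1)) := by
      rw [List.drop_eq_getElem_cons hi', wdeg_cons, wdeg_append, hsb, hb]
    rw [e, mul_comm (wdeg (v.take i)), sgn_add, sgn_mul_self, one_mul]
  · simp [cyclicSum]

/-- The action of `ψ_3` on cyclic words is, up to a factor, the derivation with `θ ↦ ξ θ ξ_L`,
`η ↦ -ξ_L η ξ`, `id_𝒪 ↦ θ ξ_L η` and `id_L ↦ η ξ θ`. -/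
def psiDerivation (R : List Gen → ℂ) (v : List Gen) : ℂ :=
  insertSum [.xi, .theta, .xiL] .theta R v - insertSum [.xiL, .eta, .xi] .eta R v +
    insertSum [.theta, .xiL, .eta] .idO R v + insertSum [.eta, .xi, .theta] .idL R v

theorem cyclicSum_contractHead_psi3_rotCount (z : ℂ) (v u : List Gen) :
    cyclicSum (contractHead (psi3 z) (rotCount v)) u =
      psiScale z * psiDerivation (fun w => rotCount w u) v := by
  have huniv : (Finset.univ : Finset Gen) =
      ([.idO, .idL, .xi, .xiL, .theta, .eta] : List Gen).toFinset := by decide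
  have h (w : List Gen) : contractHead (psi3 z) (rotCount v) w =
      psiScale z * (if w.take 3 = [.xi, .theta, .xiL] then rotCount v (.theta :: w.drop 3) else 0) +
      -psiScale z * (if w.take 3 = [.xiL, .eta, .xi] then rotCount v (.eta :: w.drop 3) else 0) +
      psiScale z * (if w.take 3 = [.theta, .xiL, .eta] then rotCount v (.idO :: w.drop 3) else 0) +
      psiScale z *
        (if w.take 3 = [.eta, .xi, .theta] then rotCount v (.idL :: w.drop 3) else 0) := by
    rw [contractHead, huniv, List.sum_toFinset _ (by decide)]
    simp only [List.map_cons, List.map_nil, List.sum_cons, List.sum_nil, psi3_onWord, psiInt]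
    push_cast
    split_ifs <;> ring
  rw [funext h, cyclicSum_add, cyclicSum_add, cyclicSum_add]
  simp only [cyclicSum_const_mul]
  rw [cyclicSum_contract_rotCount rfl rfl, cyclicSum_contract_rotCount rfl rfl,
    cyclicSum_contract_rotCount rfl rfl, cyclicSum_contract_rotCount rfl rfl, psiDerivation]
  ring

/-! ### The cyclic words of the higher multiplications -/

/-- The cyclic word `ξ_L^a η ξ^b θ ξ_L^c η ξ^d θ` attached to a quadruple `(a, b, c, d)`. -/
def cycWord (q : ℕ × ℕ × ℕ × ℕ) : List Gen := polWord q.1 q.2.1 q.2.2.1 q.2.2.2 ++ [Gen.theta]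

/-- The sum of the entries of a quadruple. -/
def quadSum (q : ℕ × ℕ × ℕ × ℕ) : ℕ := q.1 + q.2.1 + q.2.2.1 + q.2.2.2

theorem cycWord_eq (a b c d : ℕ) : cycWord (a, b, c, d) =
    List.replicate a Gen.xiL ++ (Gen.eta :: (List.replicate b Gen.xi ++ (Gen.theta ::
      (List.replicate c Gen.xiL ++ (Gen.eta :: (List.replicate d Gen.xi ++ [Gen.theta])))))) := by
  simp [cycWord, polWord]

/-- Half of a cyclic word, up to the first letter `θ`. -/
def halfWord (a b : ℕ) : List Gen :=
  List.replicate a Gen.xiL ++ Gen.eta :: (List.replicate b Gen.xi ++ [Gen.theta])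

theorem cycWord_eq_halfWord (a b c d : ℕ) :
    cycWord (a, b, c, d) = halfWord a b ++ halfWord c d := by
  simp [cycWord_eq, halfWord]

theorem length_halfWord (a b : ℕ) : (halfWord a b).length = a + b + 2 := by
  simp [halfWord]
  ring

theorem length_cycWord (q : ℕ × ℕ × ℕ × ℕ) : (cycWord q).length = quadSum q + 4 := by
  obtain ⟨a, b, c, d⟩ := q
  simp [cycWord_eq, quadSum]
  ring

theorem wdeg_replicate_xi (n : ℕ) : wdeg (List.replicate n Gen.xi) = 0 := by
  simp [wdeg, sdeg, deg]

theorem wdeg_replicate_xiL (n : ℕ) : wdeg (List.replicate n Gen.xiL) = 0 := by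
  simp [wdeg, sdeg, deg]

theorem replicate_append_cons_inj {x y : Gen} (h : x ≠ y) {m n : ℕ} {v w : List Gen}
    (e : List.replicate m x ++ y :: v = List.replicate n x ++ y :: w) : m = n ∧ v = w := by
  induction m generalizing n with
  | zero =>
    cases n with
    | zero => simpa using e
    | succ n => simp [List.replicate_succ, h.symm] at e
  | succ m ih =>
    cases n with
    | zero => simp [List.replicate_succ, h] at e
    | succ n => simpa using ih (by simpa [List.replicate_succ] using e)

theorem cycWord_injective : Function.Injective cycWord := by
  rintro ⟨a, b, c, d⟩ ⟨a', b', c', d'⟩ h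
  rw [cycWord_eq, cycWord_eq] at h
  obtain ⟨ha, h⟩ := replicate_append_cons_inj (by simp) h
  obtain ⟨hb, h⟩ := replicate_append_cons_inj (by simp) h
  obtain ⟨hc, h⟩ := replicate_append_cons_inj (by simp) h
  obtain ⟨hd, _⟩ := replicate_append_cons_inj (by simp) h
  rw [ha, hb, hc, hd]

/-- The letters `θ` of a cyclic word occur in two positions. -/
theorem cycWord_getElem?_eq_theta {a b c d i : ℕ}
    (h : (cycWord (a, b, c, d))[i]? = some Gen.theta) :
    i = a + b + 1 ∨ i = a + b + c + d + 3 := by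
  simp only [cycWord_eq, List.getElem?_append, List.getElem?_cons, List.getElem?_replicate,
    List.length_replicate, List.getElem?_nil] at h
  split_ifs at h <;> first | omega | simp at h

theorem cycWord_rotate (a b c d : ℕ) :
    (cycWord (a, b, c, d)).rotate (a + b + 2) = cycWord (c, d, a, b) := by
  rw [cycWord_eq_halfWord, ← length_halfWord, List.rotate_append_length_eq, cycWord_eq_halfWord]

theorem wdeg_halfWord (a b : ℕ) : wdeg (halfWord a b) = -1 := by
  simp [halfWord, wdeg_append, wdeg_cons, wdeg_replicate_xi, wdeg_replicate_xiL, wdeg_nil, sdeg,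
    deg]

theorem wdeg_cycWord (q : ℕ × ℕ × ℕ × ℕ) : wdeg (cycWord q) = -2 := by
  obtain ⟨a, b, c, d⟩ := q
  rw [cycWord_eq_halfWord, wdeg_append, wdeg_halfWord, wdeg_halfWord]
  rfl

/-! ### The cyclic tensor of the higher multiplications -/

/-- The quadruples with entries below `N`. -/
def quadBox (N : ℕ) : Finset (ℕ × ℕ × ℕ × ℕ) :=
  Finset.range N ×ˢ Finset.range N ×ˢ Finset.range N ×ˢ Finset.range N

theorem mem_quadBox_of_quadSum_lt {N : ℕ} {q : ℕ × ℕ × ℕ × ℕ} (h : quadSum q < N) :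
    q ∈ quadBox N := by
  simp only [quadSum] at h
  simp only [quadBox, Finset.mem_product, Finset.mem_range]
  omega

/-- The constant factor of `⟨μ_k(ξ_L^a, …, ξ^d), θ⟩`; it is zero if `a + b + c + d` is even. -/
def polConst (q : ℕ × ℕ × ℕ × ℕ) : ℂ :=
  if Odd (quadSum q) then
    -((-1) ^ (q.1 + q.2.1) /
      ((q.1.factorial * q.2.1.factorial * q.2.2.1.factorial * q.2.2.2.factorial : ℕ) : ℂ) *
        (1 / (2 * Real.pi * I) ^ (quadSum q + 1)))
  else 0

/-- The form `g_{a+c,b+d}` attached to a quadruple. -/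
def polForm (q : ℕ × ℕ × ℕ × ℕ) : ℂ → ℂ := gForm (q.1 + q.2.2.1) (q.2.1 + q.2.2.2)

theorem polConst_mul_polForm {q : ℕ × ℕ × ℕ × ℕ} (h : Odd (quadSum q)) (z : ℂ) :
    polConst q * polForm q z = -polCoeff q.1 q.2.1 q.2.2.1 q.2.2.2 z := by
  rw [polConst, if_pos h, polForm, polCoeff, quadSum]
  ring

theorem polBase_eq (z : ℂ) (w : List Gen) : polBase z w =
    ∑ q ∈ quadBox w.length, polConst q * polForm q z * if w = cycWord q then 1 else 0 := by
  rw [polBase, quadBox, Finset.sum_product]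
  refine Finset.sum_congr rfl fun a _ => ?_
  rw [Finset.sum_product]
  refine Finset.sum_congr rfl fun b _ => ?_
  rw [Finset.sum_product]
  refine Finset.sum_congr rfl fun c _ => Finset.sum_congr rfl fun d _ => ?_
  by_cases h : Odd (quadSum (a, b, c, d))
  · rw [polConst_mul_polForm h]
    by_cases hw : w = cycWord (a, b, c, d)
    · rw [if_pos hw, if_pos ⟨h, hw⟩]
      simp [pairGen]
    · rw [if_neg hw, if_neg fun h' => hw h'.2, mul_zero]
  · rw [polConst, if_neg h, if_neg, zero_mul, zero_mul]
    exact fun h' => h h'.1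

theorem polBase_cycWord {a b c d : ℕ} (h : Odd (a + b + c + d)) (z : ℂ) :
    polBase z (cycWord (a, b, c, d)) = -polCoeff a b c d z := by
  rw [polBase_eq, Finset.sum_eq_single (a, b, c, d)]
  · rw [polConst_mul_polForm (q := (a, b, c, d)) h, if_pos rfl, mul_one]
  · intro q _ hq
    rw [if_neg fun h' => hq (cycWord_injective h').symm, mul_zero]
  · intro h'
    exact absurd (mem_quadBox_of_quadSum_lt (by rw [length_cycWord]; omega)) h'

theorem exists_eq_cycWord_of_polBase_ne_zero {z : ℂ} {w : List Gen} (h : polBase z w ≠ 0) :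
    ∃ q, w = cycWord q := by
  rw [polBase_eq] at h
  obtain ⟨q, _, hq⟩ := Finset.exists_ne_zero_of_sum_ne_zero h
  exact ⟨q, by_contra fun h' => hq (by rw [if_neg h', mul_zero])⟩

/-- The cyclic tensor of the higher multiplications. -/
def polTensor (z : ℂ) (w : List Gen) : ℂ := 1 / 2 * cyclicSum (polBase z) w

theorem polTensor_eq_sum (z : ℂ) {u : List Gen} {N : ℕ} (hN : u.length ≤ N) : polTensor z u =
    ∑ q ∈ quadBox N, 1 / 2 * (polConst q * polForm q z) * rotCount (cycWord q) u := by
  have h1 : cyclicSum (polBase z) u =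
      ∑ q ∈ quadBox u.length, polConst q * polForm q z * rotCount (cycWord q) u := by
    simp only [rotCount, ← cyclicSum_const_mul]
    rw [← cyclicSum_finsetSum]
    refine Finset.sum_congr rfl fun r _ => ?_
    rw [polBase_eq, List.length_rotate]
  rw [polTensor, h1, Finset.mul_sum]
  refine (Finset.sum_subset ?_ fun q _ hq => ?_).trans
    (Finset.sum_congr rfl fun q _ => by rw [mul_assoc (1 / 2 : ℂ)])
  · intro q
    simp only [quadBox, Finset.mem_product, Finset.mem_range]
    omega
  · rw [rotCount_eq_zero_of_length_ne, mul_zero, mul_zero]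
    intro h
    rw [length_cycWord] at h
    exact hq (mem_quadBox_of_quadSum_lt (by omega))

theorem polCoeff_swap {a b c d : ℕ} (h : Odd (a + b + c + d)) (z : ℂ) :
    polCoeff c d a b z = -polCoeff a b c d z := by
  have hs : (-1 : ℂ) ^ (c + d) = -(-1) ^ (a + b) := by
    have h1 : (-1 : ℂ) ^ (a + b) * (-1) ^ (c + d) = -1 := by
      rw [← pow_add, ← add_assoc, h.neg_one_pow]
    have h2 : (-1 : ℂ) ^ (a + b) * (-1) ^ (a + b) = 1 := by
      rw [← mul_pow]
      norm_num
    linear_combination (-1 : ℂ) ^ (a + b) * h1 - (-1 : ℂ) ^ (c + d) * h2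
  rw [polCoeff, polCoeff, hs, add_comm c a, add_comm d b,
    show c + d + a + b + 1 = a + b + c + d + 1 by ring,
    show c.factorial * d.factorial * a.factorial * b.factorial =
      a.factorial * b.factorial * c.factorial * d.factorial by ring]
  ring

/-- The two presentations `(a, b, c, d)` and `(c, d, a, b)` of the cyclic word contribute equally,
which cancels the factor `1/2`. -/
theorem polTensor_cycWord {a b c d : ℕ} (h : Odd (a + b + c + d)) (z : ℂ) :
    polTensor z (cycWord (a, b, c, d)) = -polCoeff a b c d z := by
  have hlen : (cycWord (a, b, c, d)).length = a + b + c + d + 4 := length_cycWord _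
  have h0 : cyclicSum (polBase z) (cycWord (a, b, c, d)) =
      -polCoeff a b c d z + -polCoeff a b c d z := by
    rw [cyclicSum, Finset.sum_eq_add_of_mem 0 (a + b + 2) (by simp [hlen])
      (by simp only [hlen, Finset.mem_range]; omega) (by omega)]
    · congr 1
      · simp [wdeg_nil, sgn_zero, polBase_cycWord h]
      · have h' : Odd (c + d + a + b) := by rwa [show c + d + a + b = a + b + c + d by ring]
        rw [cycWord_rotate, polBase_cycWord h', polCoeff_swap h, cycWord_eq_halfWord,
          ← length_halfWord, List.take_left, List.drop_left, wdeg_halfWord, wdeg_halfWord]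
        simp [sgn]
    · rintro r hr ⟨hr0, hr1⟩
      rw [Finset.mem_range, hlen] at hr
      by_contra hne
      obtain ⟨⟨a', b', c', d'⟩, hq⟩ := exists_eq_cycWord_of_polBase_ne_zero
        (right_ne_zero_of_mul hne)
      have hl : a' + b' + c' + d' + 4 = a + b + c + d + 4 := by
        have := congrArg List.length hq
        rw [List.length_rotate, hlen, length_cycWord] at this
        exact this.symm
      -- the rotated word ends in the letter `θ`, which is the letter before the cut
      have hlast : (cycWord (a', b', c', d'))[a + b + c + d + 3]? = some Gen.theta := by
        rw [show a + b + c + d + 3 = (polWord a' b' c' d').length by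
          have := length_cycWord (a', b', c', d')
          simp only [cycWord, quadSum, List.length_append, List.length_singleton] at this
          omega]
        simp [cycWord]
      rw [← hq, List.getElem?_rotate (by omega), hlen,
        show a + b + c + d + 3 + r = r - 1 + (a + b + c + d + 4) by omega, Nat.add_mod_right,
        Nat.mod_eq_of_lt (by omega)] at hlast
      rcases cycWord_getElem?_eq_theta hlast with h1 | h1 <;> omega
  rw [polTensor, h0]
  ring

theorem isCyclicTensor_polTensor (z : ℂ) : IsCyclicTensor (polTensor z) :=
  (isCyclicTensor_cyclicSum _).const_mul _

theorem exists_rotate_of_polTensor_ne_zero {z : ℂ} {w : List Gen} (h : polTensor z w ≠ 0) :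
    ∃ r q, w.rotate r = cycWord q := by
  obtain ⟨r, hr⟩ := exists_rotate_of_cyclicSum_ne_zero (right_ne_zero_of_mul h)
  exact ⟨r, exists_eq_cycWord_of_polBase_ne_zero hr⟩

/-- The cyclic tensor of all multiplications. -/
def muTensor (z : ℂ) (w : List Gen) : ℂ := mu2Tensor w + polTensor z w

theorem mu_eq (z : ℂ) : mu z = ofTensor (muTensor z) := by
  refine cochain_ext fun w => funext fun x => ?_
  have h : mu z = mu2 + ofTensor (polTensor z) := rfl
  rw [h, mu2_eq, onWord_add, Pi.add_apply]
  simp only [onWord_ofTensor, muTensor]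
  ring

theorem isCyclicTensor_muTensor (z : ℂ) : IsCyclicTensor (muTensor z) := by
  intro x v
  simp only [muTensor, isCyclicTensor_mu2Tensor x v, isCyclicTensor_polTensor z x v]
  ring

theorem wdeg_of_muTensor_ne_zero {z : ℂ} {w : List Gen} (h : muTensor z w ≠ 0) : wdeg w = -2 := by
  by_cases h0 : mu2Tensor w = 0
  · rw [muTensor, h0, zero_add] at h
    obtain ⟨r, q, hq⟩ := exists_rotate_of_polTensor_ne_zero h
    rw [← wdeg_rotate w r, hq, wdeg_cycWord]
  · exact wdeg_of_mu2Tensor_ne_zero h0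

theorem mu2Tensor_eq_zero_of_length {w : List Gen} (h : w.length ≠ 3) : mu2Tensor w = 0 := by
  have key (x y z : Gen) : rotCount [x, y, z] w = 0 := rotCount_eq_zero_of_length_ne h
  simp [mu2Tensor, key]

theorem mu_onWord_polWord {a b c d : ℕ} (h : Odd (a + b + c + d)) (z : ℂ) :
    (mu z).onWord (polWord a b c d) = polCoeff a b c d z • vec Gen.eta := by
  have hlen (x : Gen) : (polWord a b c d ++ [dual x]).length = a + b + c + d + 4 := by
    have := length_cycWord (a, b, c, d)
    simp only [cycWord, quadSum, List.length_append, List.length_singleton] at this ⊢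
    exact this
  funext x
  rw [mu_eq, onWord_ofTensor, muTensor, mu2Tensor_eq_zero_of_length (by rw [hlen]; omega), zero_add,
    Pi.smul_apply, smul_eq_mul]
  by_cases hx : x = Gen.eta
  · subst hx
    have h1 : polTensor z (polWord a b c d ++ [dual Gen.eta]) = -polCoeff a b c d z :=
      polTensor_cycWord h z
    rw [h1]
    simp [pairGen, dual, vec]
  · have h0 : polTensor z (polWord a b c d ++ [dual x]) = 0 := by
      by_contra h0
      obtain ⟨r, ⟨a', b', c', d'⟩, hq⟩ := exists_rotate_of_polTensor_ne_zero h0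
      -- the cyclic words contain the letter `θ` twice
      have hc := (List.rotate_perm (polWord a b c d ++ [dual x]) r).count_eq Gen.theta
      rw [hq, cycWord_eq] at hc
      simp only [polWord, List.count_append, List.count_cons, List.count_nil,
        List.count_replicate] at hc
      revert hx hc
      cases x <;> simp [dual]
    rw [h0]
    simp [vec, hx]

/-! ### The derivation on the cyclic words -/

theorem cyclicSum_congr {f g : List Gen → ℂ} {u : List Gen}
    (h : ∀ w, w.length = u.length → f w = g w) : cyclicSum f u = cyclicSum g u :=
  Finset.sum_congr rfl fun r _ => by rw [h _ (List.length_rotate u r)]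

theorem contractHead_add (g : Cochain) (T T' : List Gen → ℂ) (w : List Gen) :
    contractHead g (fun v => T v + T' v) w = contractHead g T w + contractHead g T' w := by
  simp only [contractHead, mul_add, Finset.sum_add_distrib]

theorem contractHead_const_mul (g : Cochain) (k : ℂ) (T : List Gen → ℂ) (w : List Gen) :
    contractHead g (fun v => k * T v) w = k * contractHead g T w := by
  simp only [contractHead, Finset.mul_sum]
  exact Finset.sum_congr rfl fun b _ => by ring

theorem contractHead_finsetSum {ι : Type*} (s : Finset ι) (g : Cochain) (T : ι → List Gen → ℂ)
    (w : List Gen) :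
    contractHead g (fun v => ∑ i ∈ s, T i v) w = ∑ i ∈ s, contractHead g (T i) w := by
  simp only [contractHead, Finset.mul_sum]
  exact Finset.sum_comm

/-- A letter of shifted degree zero may be moved from the end of a word to its beginning. -/
theorem rotCount_concat_of_sdeg_eq_zero {x : Gen} (hx : sdeg x = 0) (v u : List Gen) :
    rotCount (v ++ [x]) u = rotCount (x :: v) u := by
  rw [rotCount_append, wdeg_cons, wdeg_nil, hx, add_zero, mul_zero, sgn_zero, one_mul]
  rfl

/-- The derivation raises two adjacent exponents of a cyclic word, in the four possible ways. -/
theorem psiDerivation_cycWord (a b c d : ℕ) (u : List Gen) :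
    psiDerivation (fun w => rotCount w u) (cycWord (a, b, c, d)) =
      rotCount (cycWord (a, b + 1, c + 1, d)) u + rotCount (cycWord (a + 1, b, c, d + 1)) u -
        rotCount (cycWord (a + 1, b + 1, c, d)) u - rotCount (cycWord (a, b, c + 1, d + 1)) u := by
  have e1 : cycWord (a, b + 1, c + 1, d) = List.replicate a Gen.xiL ++ (Gen.eta ::
      (List.replicate b Gen.xi ++ (Gen.xi :: Gen.theta :: Gen.xiL :: (List.replicate c Gen.xiL ++
        (Gen.eta :: (List.replicate d Gen.xi ++ [Gen.theta])))))) := by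
    simp [cycWord_eq, List.replicate_succ' (n := b), List.replicate_succ (n := c)]
  have e2 : cycWord (a + 1, b, c, d + 1) = Gen.xiL :: (List.replicate a Gen.xiL ++ (Gen.eta ::
      (List.replicate b Gen.xi ++ (Gen.theta :: (List.replicate c Gen.xiL ++
        (Gen.eta :: (List.replicate d Gen.xi ++ [Gen.xi, Gen.theta]))))))) := by
    simp [cycWord_eq, List.replicate_succ' (n := d), List.replicate_succ (n := a)]
  have e3 : cycWord (a + 1, b + 1, c, d) = List.replicate a Gen.xiL ++
      (Gen.xiL :: Gen.eta :: Gen.xi :: (List.replicate b Gen.xi ++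
        (Gen.theta :: (List.replicate c Gen.xiL ++
        (Gen.eta :: (List.replicate d Gen.xi ++ [Gen.theta])))))) := by
    simp [cycWord_eq, List.replicate_succ' (n := a), List.replicate_succ (n := b)]
  have e4 : cycWord (a, b, c + 1, d + 1) = List.replicate a Gen.xiL ++ (Gen.eta ::
      (List.replicate b Gen.xi ++ (Gen.theta :: (List.replicate c Gen.xiL ++
        (Gen.xiL :: Gen.eta :: Gen.xi :: (List.replicate d Gen.xi ++ [Gen.theta])))))) := by
    simp [cycWord_eq, List.replicate_succ' (n := c), List.replicate_succ (n := d)]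
  rw [e1, e2, e3, e4, ← rotCount_concat_of_sdeg_eq_zero rfl, cycWord_eq, psiDerivation]
  simp [insertSum_replicate_append, insertSum_cons, insertSum_nil]
  ring

/-- The derivation of the tensor of `μ_2`: the words with identities cancel. -/
theorem cyclicSum_contractHead_mu2Tensor (z : ℂ) (u : List Gen) :
    cyclicSum (contractHead (psi3 z) mu2Tensor) u =
      psiScale z * (rotCount (cycWord (1, 0, 0, 0)) u + rotCount (cycWord (0, 1, 0, 0)) u) := by
  have h : cyclicSum (contractHead (psi3 z) mu2Tensor) u =
      psiScale z * (-psiDerivation (fun w => rotCount w u) [Gen.idO, Gen.idO, Gen.xi] -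
        psiDerivation (fun w => rotCount w u) [Gen.idL, Gen.idL, Gen.xiL] +
        psiDerivation (fun w => rotCount w u) [Gen.theta, Gen.eta, Gen.idO] -
        psiDerivation (fun w => rotCount w u) [Gen.eta, Gen.theta, Gen.idL]) := by
    have h1 (w : List Gen) : contractHead (psi3 z) mu2Tensor w =
        -1 * contractHead (psi3 z) (rotCount [Gen.idO, Gen.idO, Gen.xi]) w +
        -1 * contractHead (psi3 z) (rotCount [Gen.idL, Gen.idL, Gen.xiL]) w +
        1 * contractHead (psi3 z) (rotCount [Gen.theta, Gen.eta, Gen.idO]) w +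
        -1 * contractHead (psi3 z) (rotCount [Gen.eta, Gen.theta, Gen.idL]) w := by
      simp only [← contractHead_const_mul, ← contractHead_add]
      congr 1
      funext v
      rw [mu2Tensor]
      ring
    simp only [funext h1, cyclicSum_add, cyclicSum_const_mul,
      cyclicSum_contractHead_psi3_rotCount]
    ring
  have s0 : sgn 0 = 1 := sgn_zero
  have s1 : sgn 1 = -1 := by simp [sgn]
  -- The words are brought into common rotations, so that those with identities cancel.
  have r1 : rotCount [Gen.idO, Gen.theta, Gen.xiL, Gen.eta, Gen.xi] u =
      sgn 1 * rotCount [Gen.theta, Gen.xiL, Gen.eta, Gen.xi, Gen.idO] u :=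
    rotCount_append [Gen.idO] _ u
  have r2 : rotCount [Gen.theta, Gen.xiL, Gen.eta, Gen.idO, Gen.xi] u =
      sgn 0 * rotCount [Gen.xi, Gen.theta, Gen.xiL, Gen.eta, Gen.idO] u :=
    rotCount_append [Gen.theta, Gen.xiL, Gen.eta, Gen.idO] [Gen.xi] u
  have r3 : rotCount [Gen.eta, Gen.xi, Gen.theta, Gen.idL, Gen.xiL] u =
      sgn 0 * rotCount [Gen.xiL, Gen.eta, Gen.xi, Gen.theta, Gen.idL] u :=
    rotCount_append [Gen.eta, Gen.xi, Gen.theta, Gen.idL] [Gen.xiL] u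
  have r4 : rotCount [Gen.idL, Gen.eta, Gen.xi, Gen.theta, Gen.xiL] u =
      sgn 1 * rotCount [Gen.eta, Gen.xi, Gen.theta, Gen.xiL, Gen.idL] u :=
    rotCount_append [Gen.idL] _ u
  have r5 : rotCount [Gen.theta, Gen.eta, Gen.theta, Gen.xiL, Gen.eta] u =
      sgn 0 * rotCount (cycWord (1, 0, 0, 0)) u :=
    rotCount_append [Gen.theta, Gen.eta, Gen.theta] _ u
  have r6 : rotCount [Gen.eta, Gen.theta, Gen.eta, Gen.xi, Gen.theta] u =
      sgn 1 * rotCount (cycWord (0, 1, 0, 0)) u :=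
    rotCount_append [Gen.eta, Gen.theta] _ u
  rw [h]
  congr 1
  simp only [psiDerivation, insertSum_cons, insertSum_nil, reduceCtorEq, if_true, if_false,
    List.cons_append, List.nil_append]
  rw [r1, r2, r3, r4, r5, r6, s0, s1]
  ring

/-- The derivation of the tensor of the higher multiplications, termwise. -/
theorem cyclicSum_contractHead_polTensor (z : ℂ) {u : List Gen} {N : ℕ} (hN : u.length < N) :
    cyclicSum (contractHead (psi3 z) (polTensor z)) u =
      psiScale z * ∑ q ∈ quadBox N, 1 / 2 * (polConst q * polForm q z) *
        psiDerivation (fun w => rotCount w u) (cycWord q) := by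
  have h (w : List Gen) (hw : w.length = u.length) : contractHead (psi3 z) (polTensor z) w =
      ∑ q ∈ quadBox N, 1 / 2 * (polConst q * polForm q z) *
        contractHead (psi3 z) (rotCount (cycWord q)) w := by
    simp only [← contractHead_const_mul]
    rw [← contractHead_finsetSum]
    refine Finset.sum_congr rfl fun b _ => ?_
    rw [polTensor_eq_sum z (N := N) (by simp; omega)]
  rw [cyclicSum_congr h, cyclicSum_finsetSum, Finset.mul_sum]
  refine Finset.sum_congr rfl fun q _ => ?_
  rw [cyclicSum_const_mul, cyclicSum_contractHead_psi3_rotCount]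
  ring

/-! ### Comparison of the coefficients -/

/-- Reindexing of a sum over quadruples by an injective map which raises the sum of the entries. -/
theorem sum_quadBox_shift {σ : ℕ × ℕ × ℕ × ℕ → ℕ × ℕ × ℕ × ℕ} (hσ : Function.Injective σ)
    (hsum : ∀ q, quadSum q ≤ quadSum (σ q)) {κ K F : ℕ × ℕ × ℕ × ℕ → ℂ} {N : ℕ}
    (hF : ∀ q, N ≤ quadSum q → F q = 0) (hκ : ∀ q, K (σ q) = κ q)
    (hK : ∀ q, q ∉ Set.range σ → K q = 0) :
    ∑ q ∈ quadBox N, κ q * F (σ q) = ∑ q ∈ quadBox N, K q * F q := by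
  have hout (q : ℕ × ℕ × ℕ × ℕ) (hq : q ∉ quadBox N) : N ≤ quadSum q :=
    not_lt.1 fun h => hq (mem_quadBox_of_quadSum_lt h)
  rw [← tsum_eq_sum (L := SummationFilter.unconditional _)
    (f := fun q => κ q * F (σ q)) fun q hq => by
      rw [hF _ ((hout q hq).trans (hsum q)), mul_zero],
    ← tsum_eq_sum (L := SummationFilter.unconditional _)
    (f := fun q => K q * F q) fun q hq => by rw [hF _ (hout q hq), mul_zero]]
  refine (tsum_congr fun q => by rw [← hκ]).trans (hσ.tsum_eq (f := fun q => K q * F q) ?_)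
  intro q hq
  by_contra h
  exact hq (by beta_reduce; rw [hK q h, zero_mul])

/-- The coefficients of the word of `q` in the derivation, up to the factors `± a b`, `± b c`,
`± c d` and `± a d`. -/
def polLowered (q : ℕ × ℕ × ℕ × ℕ) (z : ℂ) : ℂ :=
  polConst q * (2 * Real.pi * I) ^ 2 *
    gForm (q.1 + q.2.2.1 - 1) (q.2.1 + q.2.2.2 - 1) z

theorem smoothUpper_polConst_mul_polForm (q : ℕ × ℕ × ℕ × ℕ) :
    SmoothUpper fun z => polConst q * polForm q z := by
  by_cases h : Odd (quadSum q)
  · refine contDiffOn_const.mul (smoothUpper_gForm ?_)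
    rw [quadSum] at h
    rwa [show q.1 + q.2.2.1 + (q.2.1 + q.2.2.2) = q.1 + q.2.1 + q.2.2.1 + q.2.2.2 by ring]
  · simp only [polConst, if_neg h, zero_mul]
    exact contDiffOn_const

/-- The antiholomorphic derivatives of the coefficients. Since `∂g_{p,q}/∂τ̄` is proportional to
`p q g_{p-1,q-1}` for `p = a + c` and `q = b + d`, it is the sum of four terms, according to
`p q = a b + b c + c d + a d`; the remaining term is the contribution of `μ_2`. -/
theorem dTauBar_polConst_mul_polForm (q : ℕ × ℕ × ℕ × ℕ) {z : ℂ} (hz : z ∈ upperHalfPlaneSet) :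
    dTauBar (fun t => polConst q * polForm q t) z =
      psiScale z * (-((q.1 * q.2.1 + q.2.1 * q.2.2.1 + q.2.2.1 * q.2.2.2 + q.1 * q.2.2.2 : ℕ) : ℂ) *
        polLowered q z + if quadSum q = 1 then -(-1) ^ (q.1 + q.2.1) else 0) := by
  have h0 := tauDiff_ne_zero hz
  have hpi := Complex.two_pi_I_ne_zero
  by_cases h : Odd (quadSum q)
  · have hodd : Odd (q.1 + q.2.2.1 + (q.2.1 + q.2.2.2)) := by
      rw [quadSum] at h
      rwa [show q.1 + q.2.2.1 + (q.2.1 + q.2.2.2) = q.1 + q.2.1 + q.2.2.1 + q.2.2.2 by ring]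
    have hl := lower_gForm hodd hz
    rw [lower, gLower] at hl
    have e : dTauBar (polForm q) z =
        2 * Real.pi * I * ((q.1 + q.2.2.1 : ℕ) * (q.2.1 + q.2.2.2 : ℕ) *
        gForm (q.1 + q.2.2.1 - 1) (q.2.1 + q.2.2.2 - 1) z - if quadSum q = 1 then 1 else 0) /
          tauDiff z ^ 2 := by
      rw [eq_div_iff (pow_ne_zero 2 h0), mul_comm, polForm, hl,
        show q.1 + q.2.2.1 + (q.2.1 + q.2.2.2) = quadSum q by rw [quadSum]; ring]
    have hc : (if quadSum q = 1 then -(-1 : ℂ) ^ (q.1 + q.2.1) else 0) =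
        (if quadSum q = 1 then 1 else 0) * (polConst q * (2 * Real.pi * I) ^ 2) := by
      split_ifs with h1
      · have hf : q.1.factorial * q.2.1.factorial * q.2.2.1.factorial * q.2.2.2.factorial = 1 := by
          have key (n : ℕ) (hn : n ≤ 1) : n.factorial = 1 := Nat.factorial_eq_one.2 hn
          rw [quadSum] at h1
          rw [key q.1 (by omega), key q.2.1 (by omega), key q.2.2.1 (by omega),
            key q.2.2.2 (by omega)]
        rw [polConst, if_pos h, hf, h1]
        generalize (2 * Real.pi * I : ℂ) = P at hpi
        push_cast
        field_simp
      · rw [zero_mul]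
    rw [dTauBar_const_mul (f := polForm q) _ ((smoothUpper_gForm hodd).differentiableAt hz),
      e, hc, psiScale, polLowered]
    generalize (2 * Real.pi * I : ℂ) = P at hpi
    push_cast
    field_simp
    ring
  · have h1 : quadSum q ≠ 1 := by
      intro h1
      exact h (h1 ▸ odd_one)
    simp only [polLowered, polConst, if_neg h, zero_mul, mul_zero, dTauBar_const, if_neg h1,
      add_zero]

/-- Raising two exponents by one multiplies the product of the factorials by `m`, the product of the
raised exponents, which cancels against the factor `m` of the lowered form. -/
theorem polConst_shift_mul {q q' : ℕ × ℕ × ℕ × ℕ} (hs : quadSum q' = quadSum q + 2) {m : ℕ} {e : ℂ}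
    (he : (-1 : ℂ) ^ (q'.1 + q'.2.1) = e * (-1) ^ (q.1 + q.2.1))
    (hm : q'.1.factorial * q'.2.1.factorial * q'.2.2.1.factorial * q'.2.2.2.factorial =
      m * (q.1.factorial * q.2.1.factorial * q.2.2.1.factorial * q.2.2.2.factorial)) :
    (m : ℂ) * (polConst q' * (2 * Real.pi * I) ^ 2) = e * polConst q := by
  have hpi := Complex.two_pi_I_ne_zero
  have hodd : Odd (quadSum q') ↔ Odd (quadSum q) := by
    rw [hs, Nat.odd_add]
    simp
  by_cases h : Odd (quadSum q)
  · rw [polConst, polConst, if_pos h, if_pos (hodd.2 h), hs, he, hm]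
    have hm0 : m ≠ 0 := by
      rintro rfl
      rw [zero_mul] at hm
      exact absurd hm (by positivity)
    have hf0 : q.1.factorial * q.2.1.factorial * q.2.2.1.factorial * q.2.2.2.factorial ≠ 0 := by
      positivity
    generalize q.1.factorial * q.2.1.factorial * q.2.2.1.factorial * q.2.2.2.factorial = f at hf0
    have hm0' : (m : ℂ) ≠ 0 := Nat.cast_ne_zero.2 hm0
    have hf0' : (f : ℂ) ≠ 0 := Nat.cast_ne_zero.2 hf0
    generalize (2 * Real.pi * I : ℂ) = P at hpi
    push_cast
    field_simp
    ring
  · rw [polConst, polConst, if_neg h, if_neg (mt hodd.1 h)]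
    ring

/-! ### The antiholomorphic variation of the tensor -/

/-- The contribution to the derivation of the words in which a given pair of exponents is raised;
`m` is the product of these two exponents, and `e` is the change of the sign `(-1)^{a+b}`. -/
theorem sum_polConst_mul_polForm_shift {σ : ℕ × ℕ × ℕ × ℕ → ℕ × ℕ × ℕ × ℕ}
    (hσ : Function.Injective σ) (m : ℕ × ℕ × ℕ × ℕ → ℕ) {e : ℂ} (he2 : e * e = 1)
    (hac : ∀ q, (σ q).1 + (σ q).2.2.1 = q.1 + q.2.2.1 + 1)
    (hbd : ∀ q, (σ q).2.1 + (σ q).2.2.2 = q.2.1 + q.2.2.2 + 1)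
    (he : ∀ q, (-1 : ℂ) ^ ((σ q).1 + (σ q).2.1) = e * (-1) ^ (q.1 + q.2.1))
    (hm : ∀ q, (σ q).1.factorial * (σ q).2.1.factorial * (σ q).2.2.1.factorial *
      (σ q).2.2.2.factorial =
        m (σ q) * (q.1.factorial * q.2.1.factorial * q.2.2.1.factorial * q.2.2.2.factorial))
    (hm0 : ∀ q, q ∉ Set.range σ → m q = 0) (z : ℂ) {F : ℕ × ℕ × ℕ × ℕ → ℂ} {N : ℕ}
    (hF : ∀ q, N ≤ quadSum q → F q = 0) :
    ∑ q ∈ quadBox N, polConst q * polForm q z * F (σ q) =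
      ∑ q ∈ quadBox N, e * m q * polLowered q z * F q := by
  have hs (q : ℕ × ℕ × ℕ × ℕ) : quadSum (σ q) = quadSum q + 2 := by
    have h1 := hac q
    have h2 := hbd q
    simp only [quadSum]
    omega
  refine sum_quadBox_shift hσ (fun q => by rw [hs]; omega) hF (fun q => ?_) fun q hq => ?_
  · have h := polConst_shift_mul (hs q) (he q) (hm q)
    rw [polLowered, hac, hbd, Nat.add_sub_cancel, Nat.add_sub_cancel, polForm]
    linear_combination (e * gForm (q.1 + q.2.2.1) (q.2.1 + q.2.2.2) z) * h +
      (polConst q * gForm (q.1 + q.2.2.1) (q.2.1 + q.2.2.2) z) * he2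
  · rw [hm0 q hq]
    simp

/-- The quadruples of sum one contribute the derivation of the tensor of `μ_2`. -/
theorem sum_quadSum_eq_one (u : List Gen) {N : ℕ} (hN : 2 ≤ N) :
    ∑ q ∈ quadBox N, (if quadSum q = 1 then -(-1 : ℂ) ^ (q.1 + q.2.1) else 0) *
      rotCount (cycWord q) u =
        2 * (rotCount (cycWord (1, 0, 0, 0)) u + rotCount (cycWord (0, 1, 0, 0)) u) := by
  have hsub : ({(1, 0, 0, 0), (0, 1, 0, 0), (0, 0, 1, 0), (0, 0, 0, 1)} :
      Finset (ℕ × ℕ × ℕ × ℕ)) ⊆ quadBox N := by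
    intro q hq
    simp only [Finset.mem_insert, Finset.mem_singleton] at hq
    refine mem_quadBox_of_quadSum_lt ?_
    rcases hq with rfl | rfl | rfl | rfl <;> simp only [quadSum] <;> omega
  rw [← Finset.sum_subset hsub]
  · have h1 : rotCount (cycWord (0, 0, 1, 0)) u = -rotCount (cycWord (1, 0, 0, 0)) u := by
      rw [cycWord_eq_halfWord, rotCount_append, ← cycWord_eq_halfWord, wdeg_halfWord, wdeg_halfWord]
      simp [sgn]
    have h2 : rotCount (cycWord (0, 0, 0, 1)) u = -rotCount (cycWord (0, 1, 0, 0)) u := by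
      rw [cycWord_eq_halfWord, rotCount_append, ← cycWord_eq_halfWord, wdeg_halfWord, wdeg_halfWord]
      simp [sgn]
    rw [Finset.sum_insert (by decide), Finset.sum_insert (by decide), Finset.sum_insert (by decide),
      Finset.sum_singleton, h1, h2]
    simp only [quadSum]
    norm_num
    ring
  · rintro ⟨a, b, c, d⟩ _ hq
    rw [if_neg, zero_mul]
    intro h
    apply hq
    simp only [quadSum] at h
    simp only [Finset.mem_insert, Finset.mem_singleton, Prod.mk.injEq]
    omega

theorem muTensor_eq_sum (u : List Gen) {N : ℕ} (hN : u.length ≤ N) (z : ℂ) : muTensor z u =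
    mu2Tensor u + ∑ q ∈ quadBox N, 1 / 2 * rotCount (cycWord q) u *
      (polConst q * polForm q z) := by
  rw [muTensor, polTensor_eq_sum z hN]
  congr 1
  exact Finset.sum_congr rfl fun q _ => by ring

theorem differentiableAt_muTensor (u : List Gen) {z : ℂ} (hz : z ∈ upperHalfPlaneSet) :
    DifferentiableAt ℝ (fun t => muTensor t u) z := by
  rw [funext (muTensor_eq_sum u le_rfl)]
  refine (differentiableAt_const _).add (DifferentiableAt.fun_sum fun q _ => ?_)
  exact ((smoothUpper_polConst_mul_polForm q).differentiableAt hz).const_mul _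

theorem dTauBar_muTensor (u : List Gen) {z : ℂ} (hz : z ∈ upperHalfPlaneSet) :
    dTauBar (fun t => muTensor t u) z = cyclicSum (contractHead (psi3 z) (muTensor z)) u := by
  set N := u.length + 2 with hN
  set F : ℕ × ℕ × ℕ × ℕ → ℂ := fun q => rotCount (cycWord q) u with hF
  have hF0 (q : ℕ × ℕ × ℕ × ℕ) (hq : N ≤ quadSum q) : F q = 0 := by
    refine rotCount_eq_zero_of_length_ne ?_
    rw [length_cycWord]
    omega
  have hd (q : ℕ × ℕ × ℕ × ℕ) := (smoothUpper_polConst_mul_polForm q).differentiableAt hz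
  have hL : dTauBar (fun t => muTensor t u) z = ∑ q ∈ quadBox N, 1 / 2 * F q *
      (psiScale z *
        (-((q.1 * q.2.1 + q.2.1 * q.2.2.1 + q.2.2.1 * q.2.2.2 + q.1 * q.2.2.2 : ℕ) : ℂ) *
          polLowered q z + if quadSum q = 1 then -(-1) ^ (q.1 + q.2.1) else 0)) := by
    rw [funext (muTensor_eq_sum u (N := N) (by omega)), dTauBar_add (differentiableAt_const _)
      (DifferentiableAt.fun_sum fun q _ => (hd q).const_mul _), dTauBar_const, zero_add,
      dTauBar_sum _ fun q _ => (hd q).const_mul _]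
    refine Finset.sum_congr rfl fun q _ => ?_
    rw [dTauBar_const_mul _ (hd q), dTauBar_polConst_mul_polForm q hz]
  have hneg : (-1 : ℂ) * -1 = 1 := by norm_num
  -- The four ways of raising two adjacent exponents by one.
  have hbc := sum_polConst_mul_polForm_shift (σ := fun q => (q.1, q.2.1 + 1, q.2.2.1 + 1, q.2.2.2))
    (fun q q' h => by simpa [Prod.ext_iff] using h) (fun q => q.2.1 * q.2.2.1) hneg
    (fun q => by ring) (fun q => by ring) (fun q => by ring)
    (fun q => by simp only [Nat.factorial_succ]; ring)
    (by
      rintro ⟨a, b, c, d⟩ h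
      cases b
      · simp
      · cases c
        · simp
        · exact absurd ⟨(a, _, _, d), rfl⟩ h) z hF0
  have had := sum_polConst_mul_polForm_shift (σ := fun q => (q.1 + 1, q.2.1, q.2.2.1, q.2.2.2 + 1))
    (fun q q' h => by simpa [Prod.ext_iff] using h) (fun q => q.1 * q.2.2.2) hneg
    (fun q => by ring) (fun q => by ring) (fun q => by ring)
    (fun q => by simp only [Nat.factorial_succ]; ring)
    (by
      rintro ⟨a, b, c, d⟩ h
      cases a
      · simp
      · cases d
        · simp
        · exact absurd ⟨(_, b, c, _), rfl⟩ h) z hF0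
  have hab := sum_polConst_mul_polForm_shift (σ := fun q => (q.1 + 1, q.2.1 + 1, q.2.2.1, q.2.2.2))
    (fun q q' h => by simpa [Prod.ext_iff] using h) (fun q => q.1 * q.2.1) (one_mul 1)
    (fun q => by ring) (fun q => by ring) (fun q => by ring)
    (fun q => by simp only [Nat.factorial_succ]; ring)
    (by
      rintro ⟨a, b, c, d⟩ h
      cases a
      · simp
      · cases b
        · simp
        · exact absurd ⟨(_, _, c, d), rfl⟩ h) z hF0
  have hcd := sum_polConst_mul_polForm_shift (σ := fun q => (q.1, q.2.1, q.2.2.1 + 1, q.2.2.2 + 1))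
    (fun q q' h => by simpa [Prod.ext_iff] using h) (fun q => q.2.2.1 * q.2.2.2) (one_mul 1)
    (fun q => by ring) (fun q => by ring) (fun q => by ring)
    (fun q => by simp only [Nat.factorial_succ]; ring)
    (by
      rintro ⟨a, b, c, d⟩ h
      cases c
      · simp
      · cases d
        · simp
        · exact absurd ⟨(a, b, _, _), rfl⟩ h) z hF0
  have h1 := sum_quadSum_eq_one u (N := N) (by omega)
  have hR : cyclicSum (contractHead (psi3 z) (muTensor z)) u =
      psiScale z * (F (1, 0, 0, 0) + F (0, 1, 0, 0)) + psiScale z * ∑ q ∈ quadBox N,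
        1 / 2 * (polConst q * polForm q z) * (F (q.1, q.2.1 + 1, q.2.2.1 + 1, q.2.2.2) +
          F (q.1 + 1, q.2.1, q.2.2.1, q.2.2.2 + 1) - F (q.1 + 1, q.2.1 + 1, q.2.2.1, q.2.2.2) -
            F (q.1, q.2.1, q.2.2.1 + 1, q.2.2.2 + 1)) := by
    have e : contractHead (psi3 z) (muTensor z) = fun w => contractHead (psi3 z) mu2Tensor w +
        contractHead (psi3 z) (polTensor z) w := funext fun w => contractHead_add _ _ _ w
    rw [e, cyclicSum_add, cyclicSum_contractHead_mu2Tensor,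
      cyclicSum_contractHead_polTensor z (N := N) (by omega)]
    congr 2
    exact Finset.sum_congr rfl fun q _ => by rw [psiDerivation_cycWord]
  have hR' : ∑ q ∈ quadBox N, 1 / 2 * (polConst q * polForm q z) *
      (F (q.1, q.2.1 + 1, q.2.2.1 + 1, q.2.2.2) + F (q.1 + 1, q.2.1, q.2.2.1, q.2.2.2 + 1) -
        F (q.1 + 1, q.2.1 + 1, q.2.2.1, q.2.2.2) - F (q.1, q.2.1, q.2.2.1 + 1, q.2.2.2 + 1)) =
      1 / 2 * ∑ q ∈ quadBox N,
        -((q.1 * q.2.1 + q.2.1 * q.2.2.1 + q.2.2.1 * q.2.2.2 + q.1 * q.2.2.2 : ℕ) : ℂ) *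
          polLowered q z * F q := by
    have e : ∑ q ∈ quadBox N,
        -((q.1 * q.2.1 + q.2.1 * q.2.2.1 + q.2.2.1 * q.2.2.2 + q.1 * q.2.2.2 : ℕ) : ℂ) *
          polLowered q z * F q =
        ∑ q ∈ quadBox N, -1 * ((q.2.1 * q.2.2.1 : ℕ) : ℂ) * polLowered q z * F q +
        ∑ q ∈ quadBox N, -1 * ((q.1 * q.2.2.2 : ℕ) : ℂ) * polLowered q z * F q -
        ∑ q ∈ quadBox N, 1 * ((q.1 * q.2.1 : ℕ) : ℂ) * polLowered q z * F q -
        ∑ q ∈ quadBox N, 1 * ((q.2.2.1 * q.2.2.2 : ℕ) : ℂ) * polLowered q z * F q := by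
      rw [← Finset.sum_add_distrib, ← Finset.sum_sub_distrib, ← Finset.sum_sub_distrib]
      refine Finset.sum_congr rfl fun q _ => ?_
      push_cast
      ring
    rw [e, ← hbc, ← had, ← hab, ← hcd, ← Finset.sum_add_distrib, ← Finset.sum_sub_distrib,
      ← Finset.sum_sub_distrib, Finset.mul_sum]
    exact Finset.sum_congr rfl fun q _ => by ring
  rw [hL, hR, hR']
  have e : psiScale z * (F (1, 0, 0, 0) + F (0, 1, 0, 0)) = psiScale z * (1 / 2) *
      ∑ q ∈ quadBox N, (if quadSum q = 1 then -(-1 : ℂ) ^ (q.1 + q.2.1) else 0) * F q := by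
    rw [h1]
    ring
  rw [e, ← mul_assoc, ← mul_add, ← Finset.sum_add_distrib, Finset.mul_sum]
  exact Finset.sum_congr rfl fun q _ => by ring

theorem isHochschild_ofTensor {c : List Gen → ℂ} {n : ℤ} (h : ∀ w, c w ≠ 0 → wdeg w = -n) :
    IsHochschild n (ofTensor c) := by
  intro w x hx
  rw [onWord_ofTensor] at hx
  have := h _ (right_ne_zero_of_mul hx)
  rw [wdeg_append, wdeg_cons, wdeg_nil, sdeg_dual] at this
  linarith

theorem dbar_mu {z : ℂ} (hz : z ∈ upperHalfPlaneSet) : dbar mu z = bracket 2 1 (mu z) (psi3 z) := by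
  refine cochain_ext fun w => funext fun x => ?_
  have h := bracket_ofTensor (isCyclicTensor_muTensor z) (isCyclicTensor_psiTensor z)
    (fun _ => wdeg_of_muTensor_ne_zero) (fun _ => wdeg_of_psiTensor_ne_zero)
    (fun _ => length_of_psiTensor_ne_zero) w x
  rw [← mu_eq, ← psi3_eq] at h
  rw [h, dbar, onWord_ofWords, ← dTauBar_muTensor _ hz,
    ← dTauBar_const_mul _ (differentiableAt_muTensor _ hz)]
  simp only [mu_eq, onWord_ofTensor]

end Polishchuk

end

theorem mainTheorem8 (τ : ℍ) :
    -- the multiplications form a cyclic 2-cochain, with the stated values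
    (Polishchuk.IsHochschild 2 (Polishchuk.mu τ) ∧ Polishchuk.IsCyclic (Polishchuk.mu τ) ∧
      ∀ a b c d : ℕ, Odd (a + b + c + d) →
        (Polishchuk.mu τ).onWord (Polishchuk.polWord a b c d) =
          Polishchuk.polCoeff a b c d τ • Polishchuk.vec .eta) ∧
    -- `ψ_3` is a cyclic 1-cochain, with the stated value
    (Polishchuk.IsHochschild 1 (Polishchuk.psi3 τ) ∧ Polishchuk.IsCyclic (Polishchuk.psi3 τ) ∧
      (Polishchuk.psi3 τ).onWord [.xi, .theta, .xiL] =
        (-(1 / (2 * Real.pi * I)) * (1 / ((τ : ℂ) - (starRingEnd ℂ) (τ : ℂ)) ^ 2)) •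
          Polishchuk.vec .theta) ∧
    -- all structure constants are differentiable functions of `τ`
    (∀ (w : List Polishchuk.Gen) (x : Polishchuk.Gen),
      DifferentiableAt ℝ (fun z : ℂ => (Polishchuk.mu z).onWord w x) (τ : ℂ)) ∧
    -- the antiholomorphic variation is the Hochschild coboundary of `ψ_3`
    Polishchuk.dbar Polishchuk.mu τ =
      Polishchuk.bracket 2 1 (Polishchuk.mu τ) (Polishchuk.psi3 τ) := by
  have hτ : (τ : ℂ) ∈ UpperHalfPlane.upperHalfPlaneSet := τ.im_pos
  refine ⟨⟨?_, ?_, fun a b c d h => Polishchuk.mu_onWord_polWord h _⟩, ⟨?_, ?_, ?_⟩, ?_,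
    Polishchuk.dbar_mu hτ⟩
  · rw [Polishchuk.mu_eq]
    exact Polishchuk.isHochschild_ofTensor fun w => Polishchuk.wdeg_of_muTensor_ne_zero
  · rw [Polishchuk.mu_eq]
    exact (Polishchuk.isCyclicTensor_muTensor _).isCyclic_ofTensor
  · rw [Polishchuk.psi3_eq]
    exact Polishchuk.isHochschild_ofTensor fun w => Polishchuk.wdeg_of_psiTensor_ne_zero
  · rw [Polishchuk.psi3_eq]
    exact (Polishchuk.isCyclicTensor_psiTensor _).isCyclic_ofTensor
  · funext x
    rw [Polishchuk.psi3_onWord]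
    cases x <;> simp [Polishchuk.psiInt, Polishchuk.vec, Polishchuk.psiScale, Polishchuk.tauDiff]
  · intro w x
    simp only [Polishchuk.mu_eq, Polishchuk.onWord_ofTensor]
    exact (Polishchuk.differentiableAt_muTensor _ hτ).const_mul _
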